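/- For integers $P,Q$ let $U_m=U_m(P,Q)$ and $V_m=V_m(P,Q)$ be the Lucas sequences: $U_0=0$, $U_1=1$, $V_0=2$, $V_1=P$, and both satisfy $X_{m}=PX_{m-1}-QX_{m-2}$ for $m\ge 2$. Fix an integer $D$ and write $\left(\frac{D}{n}\right)$ for the Jacobi symbol. One round of the strong Lucas test on an odd number $n$ chooses $(P,Q)$ uniformly at random among the pairs with $0\le P,Q<n$, $\gcd(Q,n)=1$ and $P^2-4Q\equiv D \pmod n$. With $n-\left(\frac{D}{n}\right)=2^{\kappa}q$, $q$ odd, the number $n$ passes the round if $n\mid U_q$ or $n\mid V_{2^iq}$ for some $0\le i<\kappa$. The algorithm $\mathrm{StrongLuc}(t,k)$ repeats the following until a number is output. Choose an odd $k$-bit integer $n$ uniformly at random. Discard $n$ if $\left(\frac{D}{n}\right)\ne -1$, or $\gcd(D,n)\neq 1$, or $n$ is divisible by one of the first eight odd primes $3,5,7,11,13,17,19,23$, or $n-\left(\frac{D}{n}\right)$ is a perfect square. Otherwise perform up to $t$ independent rounds of the strong Lucas test on $n$; if $n$ fails one of them, discard $n$; if it passes all $t$, output $n$ and stop. Let $q_{k,t}$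 be the probability that $\mathrm{StrongLuc}(t,k)$ outputs a composite number. Let $k\ge 2$. 1. For all integers $0\le r<t$ such that $q_{k,r}<1$ (so that the right-hand side is defined), $$q_{k,t}\;\le\;\Big(\frac{4}{15}\Big)^{t-r}\,\frac{q_{k,r}}{1-q_{k,r}} .$$ 2. Consequently, if for some integer $r\ge 0$ one has $$q_{k,r}\le \frac{1}{1+(15/4)^r}\qquad\text{and}\qquad q_{k,r'}\le \Big(\frac{4}{15}\Big)^{r'}\ \text{ for all } 1\le r'<r,$$ then $q_{k,t}\le (4/15)^t$ for all $t\ge 1$. (For $r=1$ the condition is $q_{k,1}\le 4/19$; for $r=2$ it is $q_{k,2}\le 16/241$ and $q_{k,1}\le 4/15$.) -/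

import Mathlib

open scoped ENNReal

/-- The Lucas sequence of the first kind `U_m(P, Q)`. -/
def lucasU (P Q : ℤ) : ℕ → ℤ
  | 0 => 0
  | 1 => 1
  | m + 2 => P * lucasU P Q (m + 1) - Q * lucasU P Q m

/-- The Lucas sequence of the second kind `V_m(P, Q)`. -/
def lucasV (P Q : ℤ) : ℕ → ℤ
  | 0 => 2
  | 1 => P
  | m + 2 => P * lucasV P Q (m + 1) - Q * lucasV P Q m

/-- The criterion of the strong Lucas test for `n` with bases `P, Q`: writing
`n - (D/n) = 2 ^ κ * q` with `q` odd, either `n ∣ U_q` or `n ∣ V_{2 ^ i q}` for some `i < κ`.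
(The pair `κ, q` is unique when `n - (D/n)` is nonzero.) -/
def StrongLucasCriterion (D : ℤ) (n : ℕ) (P Q : ℤ) : Prop :=
  ∃ κ q : ℕ, Odd q ∧ (n : ℤ) - jacobiSym D n = 2 ^ κ * (q : ℤ) ∧
    ((n : ℤ) ∣ lucasU P Q q ∨ ∃ i < κ, (n : ℤ) ∣ lucasV P Q (2 ^ i * q))

open Classical in
/-- The bases of the test: pairs `(P, Q)` with `0 ≤ P, Q < n`, `gcd (Q, n) = 1` and
`P ^ 2 - 4 Q ≡ D` modulo `n`. -/
noncomputable def lucasBases (D : ℤ) (n : ℕ) : Finset (ℕ × ℕ) :=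
  (Finset.range n ×ˢ Finset.range n).filter fun b =>
    Nat.gcd b.2 n = 1 ∧ (b.1 : ℤ) ^ 2 - 4 * (b.2 : ℤ) ≡ D [ZMOD (n : ℤ)]

/-- The odd integers with exactly `k` bits. -/
def oddBits (k : ℕ) : Finset ℕ :=
  (Finset.Ico (2 ^ (k - 1)) (2 ^ k)).filter fun n => n % 2 = 1

/-- `n` survives the preliminary checks: `(D/n) = -1`, `gcd (D, n) = 1`, none of the first eight
odd primes divides `n`, and `n - (D/n)` is not a perfect square. -/
def IsLucasCandidate (D : ℤ) (n : ℕ) : Prop :=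
  jacobiSym D n = -1 ∧ Int.gcd D n = 1 ∧
    (∀ p ∈ ({3, 5, 7, 11, 13, 17, 19, 23} : Finset ℕ), ¬ p ∣ n) ∧
    ¬ IsSquare ((n : ℤ) - jacobiSym D n)

open Classical in
/-- One round of the strong Lucas test on `n`, with uniformly random bases. The value is `true` if
`n` passes. (If there are no bases at all, the round counts as failed.) -/
noncomputable def lucasRound (D : ℤ) (n : ℕ) : PMF Bool :=
  if h : (lucasBases D n).Nonempty then
    (PMF.uniformOfFinset (lucasBases D n) h).map
      fun b => decide (StrongLucasCriterion D n b.1 b.2)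
  else PMF.pure false

/-- `t` independent rounds of the strong Lucas test on `n`, stopping at the first failure. The
value is `true` if `n` passes all of them. -/
noncomputable def lucasRounds (D : ℤ) (n : ℕ) : ℕ → PMF Bool
  | 0 => PMF.pure true
  | t + 1 => (lucasRound D n).bind fun ok =>
      if ok = true then lucasRounds D n t else PMF.pure false

open Classical in
/-- One pass through the steps of the algorithm: choose an odd `k`-bit integer `n` uniformly at
random and subject it to the preliminary checks and to `t` rounds of the strong Lucas test. The
value is `some n` if `n` survives (it is then the output), and `none` if `n` is discarded. (There
is no odd `k`-bit integer only for `k = 0`.) -/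
noncomputable def strongLucAttempt (D : ℤ) (k t : ℕ) : PMF (Option ℕ) :=
  if h : (oddBits k).Nonempty then
    (PMF.uniformOfFinset (oddBits k) h).bind fun n =>
      if IsLucasCandidate D n then
        (lucasRounds D n t).map fun ok => if ok = true then some n else none
      else PMF.pure none
  else PMF.pure none

/-- The algorithm `StrongLuc(t, k)`, cut off after at most `m` candidates: its value is `some n`
if `n` has been output by then, and `none` if the algorithm is still running. -/
noncomputable def strongLuc (D : ℤ) (k t : ℕ) : ℕ → PMF (Option ℕ)
  | 0 => PMF.pure none
  | m + 1 => (strongLucAttempt D k t).bind fun out =>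
      match out with
      | some n => PMF.pure (some n)
      | none => strongLuc D k t m

/-- The outcomes of the algorithm in which a composite number is output. -/
def compositeOutput : Set (Option ℕ) :=
  {out | ∃ n : ℕ, out = some n ∧ 1 < n ∧ ¬ n.Prime}

/-- `q_{k,t}`: the probability that `StrongLuc(t, k)`, with parameter `D`, outputs a composite. The
events that a composite is output among the first `m` candidates increase with `m` to the event
that a composite is output, so its probability is the supremum of theirs. -/
noncomputable def compositeProb (D : ℤ) (k t : ℕ) : ℝ :=
  (⨆ m : ℕ, (strongLuc D k t m).toOuterMeasure compositeOutput).toReal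

/-! Conditioning on output, q_t = C_t / (C_t + P), where C_t sums a(n)^t over the composite
candidates n, a(n) is the proportion of bases for which n passes, and P is the weight of the primes.
Every prime candidate has a = 1, so P does not depend on t (`outputWeight_univ`). If a(n) ≤ 4/15 for
every composite candidate, then C_t ≤ (4/15)^(t-r) C_r, and q_t ≤ C_t / P together with C_r / P =
q_r / (1 - q_r) gives the first claim. The second restates the bound on q_r as a bound on these
odds.

The bound a(n) ≤ 4/15 is `card_passResidues_le_four_fifteenths`. A base is determined by x = P mod
n. Modulo a prime p not dividing 2D, put s = √D and τ = (x + s)/(x - s). Then τ^N = 1 for N = p -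
(D/p), and U_m or V_m vanishes exactly when τ^m is 1 or -1. Hence U_m has at most gcd(m, N) - 1
zeros and V_m at most gcd(m, N), and by the Chinese remainder theorem these counts multiply over
squarefree n.

If p² divides n, a Taylor expansion shows that at most one in p translates of a base passes. With
three or more primes the product of counts is small enough. With two primes the values gcd(q, N)
agree, and the larger N exceeds the smaller by at least their known common factor, because n + 1 is
not a square. Trial division enters as N ≥ 28. -/

section LucasPair

/-! ### Lucas sequences as coefficients of powers of x + √d. -/

variable {R : Type*} [CommRing R]

/-- The coefficients `(A, B)` of `(x + √d) ^ m = A + B √d`. -/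
def lucasPair (d x : R) : ℕ → R × R
  | 0 => (1, 0)
  | m + 1 => (x * (lucasPair d x m).1 + d * (lucasPair d x m).2,
      (lucasPair d x m).1 + x * (lucasPair d x m).2)

theorem lucasPair_succ_fst (d x : R) (m : ℕ) :
    (lucasPair d x (m + 1)).1 = x * (lucasPair d x m).1 + d * (lucasPair d x m).2 := rfl

theorem lucasPair_succ_snd (d x : R) (m : ℕ) :
    (lucasPair d x (m + 1)).2 = (lucasPair d x m).1 + x * (lucasPair d x m).2 := rfl

theorem lucasPair_map {S : Type*} [CommRing S] (f : R →+* S) (d x : R) (m : ℕ) :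
    lucasPair (f d) (f x) m = (f (lucasPair d x m).1, f (lucasPair d x m).2) := by
  induction m with
  | zero => simp [lucasPair]
  | succ m ih => ext <;> simp [lucasPair, ih]

theorem lucasPair_norm (d x : R) (m : ℕ) :
    (lucasPair d x m).1 ^ 2 - d * (lucasPair d x m).2 ^ 2 = (x ^ 2 - d) ^ m := by
  induction m with
  | zero => simp [lucasPair]
  | succ m ih => rw [pow_succ (x ^ 2 - d), ← ih, lucasPair_succ_fst, lucasPair_succ_snd]; ring

theorem lucasPair_add_sqrt {d s : R} (hs : s ^ 2 = d) (x : R) (m : ℕ) :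
    (lucasPair d x m).1 + (lucasPair d x m).2 * s = (x + s) ^ m := by
  induction m with
  | zero => simp [lucasPair]
  | succ m ih => rw [pow_succ, ← ih, lucasPair_succ_fst, lucasPair_succ_snd, ← hs]; ring

theorem lucasPair_sub_sqrt {d s : R} (hs : s ^ 2 = d) (x : R) (m : ℕ) :
    (lucasPair d x m).1 - (lucasPair d x m).2 * s = (x - s) ^ m := by
  have := lucasPair_add_sqrt (s := -s) (by rw [neg_sq, hs]) x m
  rw [sub_eq_add_neg x s, ← this]; ring

/-- First-order Taylor expansion in the base. -/
theorem lucasPair_add_of_sq_eq_zero (d x : R) {h : R} (hh : h ^ 2 = 0) (m : ℕ) :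
    (lucasPair d (x + h) (m + 1)).1 =
        (lucasPair d x (m + 1)).1 + (m + 1) * h * (lucasPair d x m).1 ∧
      (lucasPair d (x + h) (m + 1)).2 =
        (lucasPair d x (m + 1)).2 + (m + 1) * h * (lucasPair d x m).2 := by
  induction m with
  | zero => simp [lucasPair]
  | succ m ih =>
    obtain ⟨h1, h2⟩ := ih
    constructor
    · rw [lucasPair_succ_fst d (x + h), h1, h2, lucasPair_succ_fst d x (m + 1)]
      push_cast
      linear_combination ((m : R) + 1) * (lucasPair d x m).1 * hh
        - ((m : R) + 1) * h * lucasPair_succ_fst d x m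
    · rw [lucasPair_succ_snd d (x + h), h1, h2, lucasPair_succ_snd d x (m + 1)]
      push_cast
      linear_combination ((m : R) + 1) * (lucasPair d x m).2 * hh
        - ((m : R) + 1) * h * lucasPair_succ_snd d x m

/-- The characteristic roots are (P ± √d)/2. The factor 2^m clears their denominators, so that no
division is needed in the ring. -/
theorem two_pow_mul_lucasU {P Q : ℤ} {d : R} (h : (P : R) ^ 2 - 4 * (Q : R) = d) (m : ℕ) :
    (2 : R) ^ m * (lucasU P Q m : R) = 2 * (lucasPair d (P : R) m).2 := by
  induction m using Nat.twoStepInduction with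
  | zero => simp [lucasU, lucasPair]
  | one => simp [lucasU, lucasPair]
  | more m h0 h1 =>
    simp only [lucasU, lucasPair_succ_snd, lucasPair_succ_fst] at *
    push_cast
    linear_combination 2 * (P : R) * h1 - 4 * (Q : R) * h0 + 2 * (lucasPair d (P : R) m).2 * h

theorem two_pow_mul_lucasV {P Q : ℤ} {d : R} (h : (P : R) ^ 2 - 4 * (Q : R) = d) (m : ℕ) :
    (2 : R) ^ m * (lucasV P Q m : R) = 2 * (lucasPair d (P : R) m).1 := by
  induction m using Nat.twoStepInduction with
  | zero => simp [lucasV, lucasPair]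
  | one => simp [lucasV, lucasPair]
  | more m h0 h1 =>
    simp only [lucasV, lucasPair_succ_snd, lucasPair_succ_fst] at *
    push_cast
    linear_combination 2 * (P : R) * h1 - 4 * (Q : R) * h0 + 2 * (lucasPair d (P : R) m).1 * h

/-- The doubling formulas. -/
theorem lucasPair_two_mul (d x : R) (m : ℕ) :
    (lucasPair d x (2 * m)).2 = 2 * (lucasPair d x m).1 * (lucasPair d x m).2 ∧
    (lucasPair d x (2 * m)).1 = (lucasPair d x m).1 ^ 2 + d * (lucasPair d x m).2 ^ 2 := by
  induction m with
  | zero => simp [lucasPair]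
  | succ m ih =>
    obtain ⟨h2, h1⟩ := ih
    rw [show 2 * (m + 1) = 2 * m + 1 + 1 by ring]
    constructor
    · rw [lucasPair_succ_snd, lucasPair_succ_snd, lucasPair_succ_fst, h1, h2,
        lucasPair_succ_snd, lucasPair_succ_fst]
      ring
    · rw [lucasPair_succ_fst, lucasPair_succ_snd, lucasPair_succ_fst, h1, h2,
        lucasPair_succ_snd, lucasPair_succ_fst]
      ring

end LucasPair

/-! ### The conjugate ratio (x + s)/(x - s) modulo a prime. -/

section PrimeModulus

variable {p : ℕ} [Fact p.Prime] {D : ℤ}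

theorem exists_sqrt_algebraicClosure (p : ℕ) [Fact p.Prime] (D : ℤ) :
    ∃ s : AlgebraicClosure (ZMod p), s ^ 2 = (D : AlgebraicClosure (ZMod p)) :=
  IsAlgClosed.exists_pow_nat_eq _ two_pos

variable {K : Type*} [Field K] [Algebra (ZMod p) K] {s : K}

variable (K) in
theorem two_ne_zero_of_algebra_zmod (hp2 : p ≠ 2) : (2 : K) ≠ 0 := by
  have h : (2 : ZMod p) ≠ 0 := by
    have := ZMod.prime_ne_zero p 2 (Ne.symm hp2.symm)
    exact_mod_cast this
  have h' := (map_ne_zero_iff _ (algebraMap (ZMod p) K).injective).2 h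
  rwa [map_ofNat] at h'

theorem algebraMap_sq_sub_ne_zero (hs : s ^ 2 = (D : K)) {x : ZMod p}
    (hx : x ^ 2 - (D : ZMod p) ≠ 0) :
    algebraMap (ZMod p) K x + s ≠ 0 ∧ algebraMap (ZMod p) K x - s ≠ 0 := by
  have h : algebraMap (ZMod p) K (x ^ 2 - (D : ZMod p)) ≠ 0 := by
    rwa [Ne, map_eq_zero_iff _ (algebraMap (ZMod p) K).injective]
  have h2 : algebraMap (ZMod p) K (x ^ 2 - (D : ZMod p)) =
      (algebraMap (ZMod p) K x + s) * (algebraMap (ZMod p) K x - s) := by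
    simp only [map_sub, map_pow, map_intCast, ← hs]; ring
  rw [h2] at h
  exact ⟨left_ne_zero_of_mul h, right_ne_zero_of_mul h⟩

/-- The difference (x + s)^m - (x - s)^m equals 2sB, and 2s is invertible. For the first coefficient
the sum 2A plays this role. -/
theorem lucasPair_snd_eq_zero_iff (hp2 : p ≠ 2) (hs : s ^ 2 = (D : K)) (hs0 : s ≠ 0) {x : ZMod p}
    (hx : x ^ 2 - (D : ZMod p) ≠ 0) (m : ℕ) :
    (lucasPair (D : ZMod p) x m).2 = 0 ↔
      ((algebraMap (ZMod p) K x + s) / (algebraMap (ZMod p) K x - s)) ^ m = 1 := by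
  have h20 : (2 : K) ≠ 0 := two_ne_zero_of_algebra_zmod K hp2
  obtain ⟨h1, h2⟩ := algebraMap_sq_sub_ne_zero hs hx
  have hA := lucasPair_add_sqrt hs (algebraMap (ZMod p) K x) m
  have hB := lucasPair_sub_sqrt hs (algebraMap (ZMod p) K x) m
  have hm := lucasPair_map (algebraMap (ZMod p) K) (D : ZMod p) x m
  rw [map_intCast] at hm
  rw [div_pow, div_eq_one_iff_eq (pow_ne_zero _ h2), ← hA, ← hB, hm,
    ← map_eq_zero_iff _ (algebraMap (ZMod p) K).injective]
  constructor
  · intro h; simp [h]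
  · intro h
    have : 2 * s * algebraMap (ZMod p) K (lucasPair (D : ZMod p) x m).2 = 0 := by
      linear_combination h
    simpa [h20, hs0] using this

theorem lucasPair_fst_eq_zero_iff (hp2 : p ≠ 2) (hs : s ^ 2 = (D : K)) {x : ZMod p}
    (hx : x ^ 2 - (D : ZMod p) ≠ 0) (m : ℕ) :
    (lucasPair (D : ZMod p) x m).1 = 0 ↔
      ((algebraMap (ZMod p) K x + s) / (algebraMap (ZMod p) K x - s)) ^ m = -1 := by
  have h20 : (2 : K) ≠ 0 := two_ne_zero_of_algebra_zmod K hp2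
  obtain ⟨h1, h2⟩ := algebraMap_sq_sub_ne_zero hs hx
  have hA := lucasPair_add_sqrt hs (algebraMap (ZMod p) K x) m
  have hB := lucasPair_sub_sqrt hs (algebraMap (ZMod p) K x) m
  have hm := lucasPair_map (algebraMap (ZMod p) K) (D : ZMod p) x m
  rw [map_intCast] at hm
  rw [div_pow, div_eq_iff (pow_ne_zero _ h2), ← hA, ← hB, hm,
    ← map_eq_zero_iff _ (algebraMap (ZMod p) K).injective]
  constructor
  · intro h; simp [h]
  · intro h
    have : 2 * algebraMap (ZMod p) K (lucasPair (D : ZMod p) x m).1 = 0 := by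
      linear_combination h
    simpa [h20] using this

/-- Frobenius fixes x and, by Euler's criterion, multiplies s by (D/p). Hence τ^p is τ or its
inverse according to the symbol. -/
theorem lucasRatio_pow_eq_one (hp2 : p ≠ 2) (hs : s ^ 2 = (D : K)) (hD : (D : ZMod p) ≠ 0)
    {x : ZMod p} (hx : x ^ 2 - (D : ZMod p) ≠ 0) {N : ℕ} (hN : (N : ℤ) = p - legendreSym p D) :
    ((algebraMap (ZMod p) K x + s) / (algebraMap (ZMod p) K x - s)) ^ N = 1 := by
  have hpr : p.Prime := Fact.out
  have : CharP K p := charP_of_injective_algebraMap (algebraMap (ZMod p) K).injective p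
  obtain ⟨h1, h2⟩ := algebraMap_sq_sub_ne_zero hs hx
  have hxp : (algebraMap (ZMod p) K x) ^ p = algebraMap (ZMod p) K x := by
    rw [← map_pow, ZMod.pow_card]
  have hsp : s ^ p = (legendreSym p D : K) * s := by
    have h := congrArg (algebraMap (ZMod p) K) (legendreSym.eq_pow p D)
    rw [map_intCast, map_pow, map_intCast, ← hs] at h
    rw [h, ← pow_mul, ← pow_succ,
      Nat.two_mul_div_two_add_one_of_odd (hpr.odd_of_ne_two hp2)]
  have hτ : ((algebraMap (ZMod p) K x + s) / (algebraMap (ZMod p) K x - s)) ^ p =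
      (algebraMap (ZMod p) K x + (legendreSym p D : K) * s) /
        (algebraMap (ZMod p) K x - (legendreSym p D : K) * s) := by
    rw [div_pow, add_pow_char, sub_pow_char, hxp, hsp]
  have hτ0 : (algebraMap (ZMod p) K x + s) / (algebraMap (ZMod p) K x - s) ≠ 0 :=
    div_ne_zero h1 h2
  rcases legendreSym.eq_one_or_neg_one p hD with he | he
  · rw [he] at hτ hN
    have : p = N + 1 := by omega
    apply mul_right_cancel₀ hτ0
    rw [← pow_succ, ← this, hτ]; simp
  · rw [he] at hτ hN
    have : N = p + 1 := by omega
    rw [this, pow_succ, hτ]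
    rw [Int.cast_neg, Int.cast_one, neg_one_mul, sub_neg_eq_add, ← sub_eq_add_neg]
    field_simp

/-- The ratio is a Möbius transformation of x with determinant -2s ≠ 0. -/
theorem lucasRatio_injective (hp2 : p ≠ 2) (hs : s ^ 2 = (D : K)) (hs0 : s ≠ 0)
    {x y : ZMod p} (hx : x ^ 2 - (D : ZMod p) ≠ 0) (hy : y ^ 2 - (D : ZMod p) ≠ 0)
    (h : (algebraMap (ZMod p) K x + s) / (algebraMap (ZMod p) K x - s) =
      (algebraMap (ZMod p) K y + s) / (algebraMap (ZMod p) K y - s)) : x = y := by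
  have h20 : (2 : K) ≠ 0 := two_ne_zero_of_algebra_zmod K hp2
  obtain ⟨-, h2⟩ := algebraMap_sq_sub_ne_zero hs hx
  obtain ⟨-, h4⟩ := algebraMap_sq_sub_ne_zero hs hy
  rw [div_eq_div_iff h2 h4] at h
  apply (algebraMap (ZMod p) K).injective
  have h3 : 2 * s * (algebraMap (ZMod p) K x - algebraMap (ZMod p) K y) = 0 := by
    linear_combination -h
  simpa [h20, hs0, sub_eq_zero] using h3

end PrimeModulus

/-! ### Counting zeros modulo a prime. -/

section Residues

open Classical in
/-- The residues of `P` modulo `n` over all bases `(P, Q)` of the test. -/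
noncomputable def baseResidues (D : ℤ) (n : ℕ) [NeZero n] : Finset (ZMod n) :=
  Finset.univ.filter fun x => IsUnit (x ^ 2 - (D : ZMod n))

open Classical in
/-- The base residues at which `U_m` vanishes. -/
noncomputable def zerosU (D : ℤ) (n m : ℕ) [NeZero n] : Finset (ZMod n) :=
  Finset.univ.filter fun x =>
    IsUnit (x ^ 2 - (D : ZMod n)) ∧ (lucasPair (D : ZMod n) x m).2 = 0

open Classical in
/-- The base residues at which `V_m` vanishes. -/
noncomputable def zerosV (D : ℤ) (n m : ℕ) [NeZero n] : Finset (ZMod n) :=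
  Finset.univ.filter fun x =>
    IsUnit (x ^ 2 - (D : ZMod n)) ∧ (lucasPair (D : ZMod n) x m).1 = 0

variable {p : ℕ} [Fact p.Prime] {D : ℤ}

theorem card_baseResidues_prime (hp2 : p ≠ 2) :
    ((baseResidues D p).card : ℤ) = p - legendreSym p D - 1 := by
  classical
  have h := legendreSym.card_sqrts p hp2 D
  have h2 : (baseResidues D p) = ({x : ZMod p | x ^ 2 = (D : ZMod p)} : Set (ZMod p)).toFinsetᶜ := by
    ext x
    simp [baseResidues, sub_eq_zero]
  have h3 := Finset.card_le_univ ({x : ZMod p | x ^ 2 = (D : ZMod p)} : Set (ZMod p)).toFinset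
  rw [h2, Finset.card_compl, Nat.cast_sub h3, ZMod.card]
  rw [h]
  ring

theorem sqrt_ne_zero {K : Type*} [Field K] [Algebra (ZMod p) K] {s : K} (hs : s ^ 2 = (D : K))
    (hD : (D : ZMod p) ≠ 0) : s ≠ 0 := by
  rintro rfl
  apply hD
  apply (algebraMap (ZMod p) K).injective
  rw [map_intCast, ← hs]; simp

/-- The ratios of zeros are roots of unity of order dividing both m and N. The value 1 is never
attained, which saves one. -/
theorem card_zerosU_prime_le (hp2 : p ≠ 2) (hD : (D : ZMod p) ≠ 0) {N : ℕ}
    (hN : (N : ℤ) = p - legendreSym p D) (hN0 : 0 < N) (m : ℕ) :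
    (zerosU D p m).card ≤ Nat.gcd m N - 1 := by
  classical
  obtain ⟨s, hs⟩ := exists_sqrt_algebraicClosure p D
  have hs0 := sqrt_ne_zero hs hD
  let K := AlgebraicClosure (ZMod p)
  have hg : 0 < Nat.gcd m N := Nat.gcd_pos_of_pos_right _ hN0
  have h1 : (1 : K) ∈ Polynomial.nthRootsFinset (Nat.gcd m N) (1 : K) := by
    rw [Polynomial.mem_nthRootsFinset hg]; simp
  have hcard : ((Polynomial.nthRootsFinset (Nat.gcd m N) (1 : K)).erase 1).card ≤
      Nat.gcd m N - 1 := by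
    rw [Finset.card_erase_of_mem h1]
    refine Nat.sub_le_sub_right ?_ 1
    exact (Multiset.toFinset_card_le _).trans (Polynomial.card_nthRoots _ _)
  refine le_trans (Finset.card_le_card_of_injOn
    (fun x => (algebraMap (ZMod p) K x + s) / (algebraMap (ZMod p) K x - s)) ?_ ?_) hcard
  · intro x hx
    simp only [zerosU, Finset.coe_filter, Finset.mem_univ, true_and, Set.mem_ofPred_eq,
      isUnit_iff_ne_zero] at hx
    obtain ⟨hx, h0⟩ := hx
    have ha := (lucasPair_snd_eq_zero_iff hp2 hs hs0 hx m).1 h0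
    have hb := lucasRatio_pow_eq_one hp2 hs hD hx hN
    simp only [Finset.coe_erase, Set.mem_sdiff, Finset.mem_coe, Set.mem_singleton_iff]
    rw [Polynomial.mem_nthRootsFinset hg]
    refine ⟨pow_gcd_eq_one.2 ⟨ha, hb⟩, ?_⟩
    intro h
    rw [div_eq_one_iff_eq (algebraMap_sq_sub_ne_zero hs hx).2] at h
    have : 2 * s = 0 := by linear_combination h
    simp [two_ne_zero_of_algebra_zmod K hp2, hs0] at this
  · intro x hx y hy hxy
    simp only [zerosU, Finset.coe_filter, Finset.mem_univ, true_and, Set.mem_ofPred_eq,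
      isUnit_iff_ne_zero] at hx hy
    exact lucasRatio_injective hp2 hs hs0 hx.1 hy.1 hxy

theorem card_zerosV_prime_le (hp2 : p ≠ 2) (hD : (D : ZMod p) ≠ 0) {N : ℕ}
    (hN : (N : ℤ) = p - legendreSym p D) (hN0 : 0 < N) (m : ℕ) :
    (zerosV D p m).card ≤ Nat.gcd m N := by
  classical
  obtain ⟨s, hs⟩ := exists_sqrt_algebraicClosure p D
  have hs0 := sqrt_ne_zero hs hD
  let K := AlgebraicClosure (ZMod p)
  have hg : 0 < Nat.gcd m N := Nat.gcd_pos_of_pos_right _ hN0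
  rcases (zerosV D p m).eq_empty_or_nonempty with he | ⟨y, hy⟩
  · simp [he]
  have hcard : (Polynomial.nthRootsFinset (Nat.gcd m N) (1 : K)).card ≤ Nat.gcd m N :=
    (Multiset.toFinset_card_le _).trans (Polynomial.card_nthRoots _ _)
  simp only [zerosV, Finset.mem_filter, Finset.mem_univ, true_and, isUnit_iff_ne_zero] at hy
  have hya := (lucasPair_fst_eq_zero_iff hp2 hs hy.1 m).1 hy.2
  have hyb := lucasRatio_pow_eq_one hp2 hs hD hy.1 hN
  set σ := (algebraMap (ZMod p) K y + s) / (algebraMap (ZMod p) K y - s)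
  have hσ0 : σ ≠ 0 := div_ne_zero (algebraMap_sq_sub_ne_zero hs hy.1).1
    (algebraMap_sq_sub_ne_zero hs hy.1).2
  -- The solutions of τ^m = -1 lie in one coset: dividing by the fixed solution σ maps them into the
  -- gcd(m, N)-th roots of unity.
  refine le_trans (Finset.card_le_card_of_injOn
    (fun x => (algebraMap (ZMod p) K x + s) / (algebraMap (ZMod p) K x - s) / σ) ?_ ?_) hcard
  · intro x hx
    simp only [zerosV, Finset.coe_filter, Finset.mem_univ, true_and, Set.mem_ofPred_eq,
      isUnit_iff_ne_zero] at hx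
    obtain ⟨hx, h0⟩ := hx
    have ha := (lucasPair_fst_eq_zero_iff hp2 hs hx m).1 h0
    have hb := lucasRatio_pow_eq_one hp2 hs hD hx hN
    rw [Finset.mem_coe, Polynomial.mem_nthRootsFinset hg]
    refine pow_gcd_eq_one.2 ⟨?_, ?_⟩
    · rw [div_pow, ha, hya]; simp
    · rw [div_pow, hb, hyb]; simp
  · intro x hx z hz hxz
    simp only [zerosV, Finset.coe_filter, Finset.mem_univ, true_and, Set.mem_ofPred_eq,
      isUnit_iff_ne_zero] at hx hz
    exact lucasRatio_injective hp2 hs hs0 hx.1 hz.1 ((div_left_inj' hσ0).1 hxz)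

/-- `V_m` has a zero only if the group order `N` is divisible by twice the `2`-part of `m`. -/
theorem two_pow_dvd_of_zerosV_nonempty (hp2 : p ≠ 2) (hD : (D : ZMod p) ≠ 0) {N : ℕ}
    (hN : (N : ℤ) = p - legendreSym p D) (hN0 : 0 < N) {i q : ℕ}
    (h : (zerosV D p (2 ^ i * q)).Nonempty) : 2 ^ (i + 1) ∣ N := by
  obtain ⟨s, hs⟩ := exists_sqrt_algebraicClosure p D
  let K := AlgebraicClosure (ZMod p)
  obtain ⟨y, hy⟩ := h
  simp only [zerosV, Finset.mem_filter, Finset.mem_univ, true_and, isUnit_iff_ne_zero] at hy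
  have hya := (lucasPair_fst_eq_zero_iff hp2 hs hy.1 _).1 hy.2
  have hyb := lucasRatio_pow_eq_one hp2 hs hD hy.1 hN
  set σ := (algebraMap (ZMod p) K y + s) / (algebraMap (ZMod p) K y - s)
  obtain ⟨c, u, hu, hcu⟩ := Nat.exists_eq_two_pow_mul_odd hN0.ne'
  by_contra hdvd
  have hci : c ≤ i := by
    by_contra hci
    exact hdvd (hcu ▸ (pow_dvd_pow 2 (by omega)).mul_right u)
  -- With c ≤ i, N divides 2^i q u, so this power is 1; but σ^(2^i q) = -1 and u is odd, so it is
  -- also -1.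
  have h1 : (σ ^ (2 ^ i * q)) ^ u = 1 := by
    obtain ⟨e, rfl⟩ := Nat.exists_eq_add_of_le hci
    rw [← pow_mul, show 2 ^ (c + e) * q * u = 2 ^ c * u * (2 ^ e * q) by ring, ← hcu, pow_mul, hyb,
      one_pow]
  rw [hya, hu.neg_one_pow] at h1
  have : (2 : K) = 0 := by linear_combination -h1
  exact two_ne_zero_of_algebra_zmod K hp2 this

/-- If `p - (D/p) = 2 ^ κ q`, then every base residue passes the strong test modulo `p`. -/
theorem prime_passes (hp2 : p ≠ 2) (hD : (D : ZMod p) ≠ 0) {κ q : ℕ}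
    (hN : ((2 ^ κ * q : ℕ) : ℤ) = p - legendreSym p D) {x : ZMod p}
    (hx : IsUnit (x ^ 2 - (D : ZMod p))) :
    (lucasPair (D : ZMod p) x q).2 = 0 ∨
      ∃ i < κ, (lucasPair (D : ZMod p) x (2 ^ i * q)).1 = 0 := by
  obtain ⟨s, hs⟩ := exists_sqrt_algebraicClosure p D
  have hs0 := sqrt_ne_zero hs hD
  rw [isUnit_iff_ne_zero] at hx
  have h := lucasRatio_pow_eq_one hp2 hs hD hx hN
  rw [← lucasPair_snd_eq_zero_iff hp2 hs hs0 hx] at h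
  have h2 : (2 : ZMod p) ≠ 0 := two_ne_zero_of_algebra_zmod (ZMod p) hp2
  clear hN
  -- Each halving of the index splits the second coefficient as 2AB, and in a field one factor
  -- vanishes.
  induction κ with
  | zero => left; simpa using h
  | succ κ ih =>
    rw [pow_succ', mul_assoc, (lucasPair_two_mul _ _ _).1, mul_eq_zero, mul_eq_zero] at h
    rcases h with (h | h) | h
    · exact absurd h h2
    · exact Or.inr ⟨κ, by omega, h⟩
    · rcases ih h with h | ⟨i, hi, h⟩
      · exact Or.inl h
      · exact Or.inr ⟨i, by omega, h⟩

end Residues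

/-! ### Passing residues modulo a composite number. -/

section Composite

open Classical in
/-- The base residues at which `n` passes the strong test with `n - (D/n) = 2 ^ κ q`. -/
noncomputable def passResidues (D : ℤ) (n κ q : ℕ) [NeZero n] : Finset (ZMod n) :=
  Finset.univ.filter fun x => IsUnit (x ^ 2 - (D : ZMod n)) ∧
    ((lucasPair (D : ZMod n) x q).2 = 0 ∨ ∃ i < κ, (lucasPair (D : ZMod n) x (2 ^ i * q)).1 = 0)

theorem card_passResidues_le (D : ℤ) (n κ q : ℕ) [NeZero n] :
    (passResidues D n κ q).card ≤
      (zerosU D n q).card + ∑ i ∈ Finset.range κ, (zerosV D n (2 ^ i * q)).card := by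
  classical
  have : passResidues D n κ q ⊆
      zerosU D n q ∪ (Finset.range κ).biUnion fun i => zerosV D n (2 ^ i * q) := by
    intro x hx
    simp only [passResidues, zerosU, zerosV, Finset.mem_union, Finset.mem_filter, Finset.mem_univ,
      true_and, Finset.mem_biUnion, Finset.mem_range] at hx ⊢
    obtain ⟨hx, h | ⟨i, hi, h⟩⟩ := hx
    · exact Or.inl ⟨hx, h⟩
    · exact Or.inr ⟨i, hi, hx, h⟩
  exact (Finset.card_le_card this).trans
    ((Finset.card_union_le _ _).trans (Nat.add_le_add_left Finset.card_biUnion_le _))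

/-- By the doubling formula, any of the alternatives forces the coefficient at the full index to
vanish. This single equation is what the Taylor argument can differentiate. -/
theorem lucasPair_two_pow_mul_eq_zero {R : Type*} [CommRing R] {d x : R} {κ q : ℕ}
    (h : (lucasPair d x q).2 = 0 ∨ ∃ i < κ, (lucasPair d x (2 ^ i * q)).1 = 0) :
    (lucasPair d x (2 ^ κ * q)).2 = 0 := by
  induction κ with
  | zero => simpa using h
  | succ κ ih =>
    rw [pow_succ', mul_assoc, (lucasPair_two_mul _ _ _).1]
    rcases h with h | ⟨i, hi, h⟩
    · rw [ih (Or.inl h), mul_zero]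
    · rcases Nat.lt_succ_iff_lt_or_eq.1 hi with hi | rfl
      · rw [ih (Or.inr ⟨i, hi, h⟩), mul_zero]
      · rw [h]; ring

/-- If `p ^ 2 ∣ n`, the translates `x + j (n / p)` of a base residue are base residues, and at most
one of them passes. -/
theorem mul_card_passResidues_le_of_sq_dvd {D : ℤ} {n κ q p : ℕ} [NeZero n] [Fact p.Prime]
    (hpn : p * p ∣ n) (hn : n + 1 = 2 ^ κ * q) :
    (passResidues D n κ q).card * p ≤ (baseResidues D n).card := by
  classical
  obtain ⟨u, hu⟩ := hpn
  have hp : p.Prime := Fact.out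
  have hn0 : n ≠ 0 := NeZero.ne n
  have hdvd : p ∣ n := ⟨p * u, by rw [hu, mul_assoc]⟩
  set h : ZMod n := ((p * u : ℕ) : ZMod n) with hh
  have hsq : h ^ 2 = 0 := by
    have : h ^ 2 = ((p * p * u : ℕ) : ZMod n) * (u : ZMod n) := by rw [hh]; push_cast; ring
    rw [this, ← hu]; simp
  have key : ∀ x ∈ passResidues D n κ q, ∀ y ∈ passResidues D n κ q, ∀ j : ℤ,
      y = x + (j : ZMod n) * h → (p : ℤ) ∣ j := by
    intro x hx y hy j hxy
    simp only [passResidues, Finset.mem_filter, Finset.mem_univ, true_and] at hx hy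
    have hbx := lucasPair_two_pow_mul_eq_zero hx.2
    have hby := lucasPair_two_pow_mul_eq_zero hy.2
    rw [← hn] at hbx hby
    -- At index n + 1 both values vanish, and n + 1 = 1 in `ZMod n`, so the expansion leaves j h b =
    -- 0.
    have ht := (lucasPair_add_of_sq_eq_zero (D : ZMod n) x
      (h := (j : ZMod n) * h) (by rw [mul_pow, hsq, mul_zero]) n).2
    rw [← hxy, hby, hbx, ZMod.natCast_self, zero_add, zero_add, one_mul] at ht
    set b := (lucasPair (D : ZMod n) x n).2 with hb
    -- If b vanished modulo p, the vanishing at index n + 1 would kill the first coefficient at n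
    -- too, and the norm (x² - D)^n would not be a unit.
    have hbp : ¬ (p : ℤ) ∣ (b.val : ℤ) := by
      intro hpb
      let f := ZMod.castHom hdvd (ZMod p)
      have hfb : f b = 0 := by
        rw [← ZMod.natCast_zmod_val b, map_natCast, ZMod.natCast_eq_zero_iff]
        exact_mod_cast hpb
      have h1 := congrArg f hbx
      rw [lucasPair_succ_snd, map_add, map_mul, ← hb, hfb, mul_zero, add_zero, map_zero] at h1
      have h2 := congrArg f (lucasPair_norm (D : ZMod n) x n)
      rw [map_sub, map_mul, map_pow, map_pow, ← hb, hfb, h1, map_pow] at h2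
      have h3 := ((hx.1.map f).pow n).ne_zero
      apply h3
      rw [← h2]
      simp
    have h4 : ((n : ℕ) : ℤ) ∣ j * (p * u : ℕ) * b.val := by
      rw [← ZMod.intCast_zmod_eq_zero_iff_dvd]
      push_cast
      rw [ZMod.natCast_zmod_val, ht, hh]
      push_cast
      ring
    have hu0 : ((p * u : ℕ) : ℤ) ≠ 0 := by
      have : p * u ≠ 0 := by rintro h0; apply hn0; rw [hu, mul_assoc, h0, mul_zero]
      exact_mod_cast this
    have h5 : (p : ℤ) ∣ j * b.val := by
      apply Int.dvd_of_mul_dvd_mul_right hu0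
      refine dvd_trans ?_ (dvd_trans h4 (dvd_of_eq ?_))
      · rw [hu]; push_cast; exact dvd_of_eq (by ring)
      · ring
    exact ((Nat.prime_iff_prime_int.1 hp).dvd_or_dvd h5).resolve_right hbp
  have hcard : (passResidues D n κ q).card * p =
      (passResidues D n κ q ×ˢ Finset.range p).card := by
    rw [Finset.card_product, Finset.card_range]
  rw [hcard]
  refine Finset.card_le_card_of_injOn (fun z => z.1 + (z.2 : ZMod n) * h) ?_ ?_
  · rintro ⟨x, j⟩ hz
    simp only [Finset.coe_product, Set.mem_prod, Finset.mem_coe] at hz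
    have hx := hz.1
    simp only [passResidues, Finset.mem_filter, Finset.mem_univ, true_and] at hx
    simp only [baseResidues, Finset.coe_filter, Finset.mem_univ, true_and, Set.mem_ofPred_eq]
    have : (x + (j : ZMod n) * h) ^ 2 - (D : ZMod n) =
        (x ^ 2 - (D : ZMod n)) + h * ((j : ZMod n) * (2 * x + (j : ZMod n) * h)) := by ring
    rw [this]
    refine IsNilpotent.isUnit_add_left_of_commute ?_ hx.1 (Commute.all _ _)
    exact ⟨2, by rw [mul_pow, hsq, zero_mul]⟩
  · rintro ⟨x, j⟩ hx ⟨y, j'⟩ hy hxy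
    simp only [Finset.coe_product, Set.mem_prod, Finset.mem_coe, Finset.mem_range] at hx hy hxy
    have h1 := key x hx.1 y hy.1 ((j : ℤ) - j') (by push_cast; linear_combination -hxy)
    have h2 : (j : ℤ) - j' = 0 := by
      apply Int.eq_zero_of_abs_lt_dvd h1
      rw [abs_lt]; omega
    have h3 : j = j' := by omega
    subst h3
    simpa using hxy

/-! ### Multiplicativity of the counts by the Chinese remainder theorem. -/

section CRT

variable {ι : Type*} [Fintype ι] {a : ι → ℕ}

theorem card_filter_eq_prod_of_crt [∀ i, NeZero (a i)]
    (hc : Pairwise (Function.onFun Nat.Coprime a))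
    [NeZero (∏ i, a i)] (P : ZMod (∏ i, a i) → Prop) [DecidablePred P]
    (Q : ∀ i, ZMod (a i) → Prop) [∀ i, DecidablePred (Q i)]
    (h : ∀ x, P x ↔ ∀ i, Q i (ZMod.prodEquivPi a hc x i)) :
    (Finset.univ.filter P).card = ∏ i, (Finset.univ.filter (Q i)).card := by
  classical
  rw [← Fintype.card_piFinset]
  refine Finset.card_equiv (ZMod.prodEquivPi a hc).toEquiv fun x => ?_
  simp [h]

variable (D : ℤ)

theorem isUnit_crt_iff (hc : Pairwise (Function.onFun Nat.Coprime a)) (x : ZMod (∏ i, a i)) : IsUnit (x ^ 2 - (D : ZMod (∏ i, a i))) ↔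
    ∀ i, IsUnit ((ZMod.prodEquivPi a hc x i) ^ 2 - (D : ZMod (a i))) := by
  rw [← MulEquiv.isUnit_map (ZMod.prodEquivPi a hc), Pi.isUnit_iff]
  simp only [map_sub, map_pow, map_intCast, Pi.sub_apply, Pi.pow_apply, Pi.intCast_apply]

theorem lucasPair_crt (hc : Pairwise (Function.onFun Nat.Coprime a)) (x : ZMod (∏ i, a i)) (m : ℕ) (i : ι) :
    lucasPair (D : ZMod (a i)) (ZMod.prodEquivPi a hc x i) m =
      (ZMod.prodEquivPi a hc (lucasPair (D : ZMod (∏ i, a i)) x m).1 i,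
        ZMod.prodEquivPi a hc (lucasPair (D : ZMod (∏ i, a i)) x m).2 i) := by
  have := lucasPair_map ((Pi.evalRingHom (fun i => ZMod (a i)) i).comp
    (ZMod.prodEquivPi a hc : ZMod (∏ i, a i) →+* _)) (D : ZMod (∏ i, a i)) x m
  rw [map_intCast] at this
  exact this

theorem card_baseResidues_prod (hc : Pairwise (Function.onFun Nat.Coprime a)) [∀ i, NeZero (a i)]
    [NeZero (∏ i, a i)] :
    (baseResidues D (∏ i, a i)).card = ∏ i, (baseResidues D (a i)).card := by
  classical
  exact card_filter_eq_prod_of_crt hc _ _ fun x => isUnit_crt_iff D hc x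

theorem crt_eq_zero_iff (hc : Pairwise (Function.onFun Nat.Coprime a)) (x : ZMod (∏ i, a i)) :
    x = 0 ↔ ∀ i, ZMod.prodEquivPi a hc x i = 0 := by
  rw [← map_eq_zero_iff _ (ZMod.prodEquivPi a hc).injective, funext_iff]
  rfl

theorem card_zerosU_prod (hc : Pairwise (Function.onFun Nat.Coprime a))
    [∀ i, NeZero (a i)] [NeZero (∏ i, a i)] (m : ℕ) :
    (zerosU D (∏ i, a i) m).card = ∏ i, (zerosU D (a i) m).card := by
  classical
  refine card_filter_eq_prod_of_crt hc _ _ fun x => ?_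
  rw [isUnit_crt_iff D hc, crt_eq_zero_iff hc, ← forall_and]
  simp only [lucasPair_crt D hc]

theorem card_zerosV_prod (hc : Pairwise (Function.onFun Nat.Coprime a))
    [∀ i, NeZero (a i)] [NeZero (∏ i, a i)] (m : ℕ) :
    (zerosV D (∏ i, a i) m).card = ∏ i, (zerosV D (a i) m).card := by
  classical
  refine card_filter_eq_prod_of_crt hc _ _ fun x => ?_
  rw [isUnit_crt_iff D hc, crt_eq_zero_iff hc, ← forall_and]
  simp only [lucasPair_crt D hc]

end CRT

end Composite

/-! ### Numerical inequalities behind 4/15. -/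

/-- Numerical bound for three or more prime factors. -/
theorem strong_lucas_numeric_many {ι : Type*} [Fintype ι] {c g : ι → ℕ} {k : ℕ} (hk : 1 ≤ k)
    (hι : 3 ≤ Fintype.card ι) (hgc : ∀ i, g i ≤ c i) (hN : ∀ i, 28 ≤ 2 ^ k * c i) :
    15 * (∏ i, (g i - 1) + (∑ j ∈ Finset.range k, (2 ^ j) ^ Fintype.card ι) * ∏ i, g i) ≤
      4 * ∏ i, (2 ^ k * c i - 1) := by
  classical
  have hc1 : ∀ i, 1 ≤ c i := fun i => by
    rcases Nat.eq_zero_or_pos (c i) with h | h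
    · have := hN i; simp [h] at this
    · exact h
  set s := Fintype.card ι with hs
  set S := ∑ j ∈ Finset.range k, (2 ^ j) ^ s with hS
  have hmono : 15 * (∏ i, (g i - 1) + S * ∏ i, g i) ≤ 15 * (∏ i, (c i - 1) + S * ∏ i, c i) := by
    gcongr with i _ i _
    · exact hgc i
    · exact hgc i
  refine hmono.trans ?_
  -- Here the crude bound of c - 1 by c used below is too lossy: 30 (28/27)^3 exceeds 32. The exact
  -- polynomial inequality for c ≥ 14 is checked instead.
  by_cases hsmall : s = 3 ∧ k = 1
  · obtain ⟨h3, rfl⟩ := hsmall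
    have hS1 : S = 1 := by simp [hS]
    rw [hs, ← Finset.card_univ, Finset.card_eq_three] at h3
    obtain ⟨x, y, z, hxy, hxz, hyz, hu⟩ := h3
    rw [hS1, one_mul, hu]
    simp only [Finset.prod_insert (show x ∉ ({y, z} : Finset ι) by simp [hxy, hxz]),
      Finset.prod_insert (show y ∉ ({z} : Finset ι) by simp [hyz]), Finset.prod_singleton]
    obtain ⟨X, hX⟩ := Nat.exists_eq_add_of_le (show 14 ≤ c x by have := hN x; omega)
    obtain ⟨Y, hY⟩ := Nat.exists_eq_add_of_le (show 14 ≤ c y by have := hN y; omega)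
    obtain ⟨Z, hZ⟩ := Nat.exists_eq_add_of_le (show 14 ≤ c z by have := hN z; omega)
    rw [hX, hY, hZ, show 14 + X - 1 = 13 + X by omega, show 14 + Y - 1 = 13 + Y by omega,
      show 14 + Z - 1 = 13 + Z by omega, show 2 ^ 1 * (14 + X) - 1 = 27 + 2 * X by omega,
      show 2 ^ 1 * (14 + Y) - 1 = 27 + 2 * Y by omega,
      show 2 ^ 1 * (14 + Z) - 1 = 27 + 2 * Z by omega]
    ring_nf
    nlinarith [mul_nonneg X.zero_le Y.zero_le]
  · have hS0 : (S : ℝ) * (2 ^ s - 1) = 2 ^ (k * s) - 1 := by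
      have := geom_sum_mul ((2 : ℝ) ^ s) k
      rw [hS, mul_comm k s, pow_mul, ← this]
      push_cast
      congr 1
      exact Finset.sum_congr rfl fun j _ => by rw [← pow_mul, ← pow_mul, mul_comm]
    have hprodN : (2 : ℝ) ^ (k * s) * ∏ i, (c i : ℝ) = ∏ i, (2 ^ k * (c i : ℝ)) := by
      rw [Finset.prod_mul_distrib, Finset.prod_const, Finset.card_univ, pow_mul]
    -- N ≤ (28/27)(N - 1) for N ≥ 28, factor by factor.
    have hN' : ∏ i, (2 ^ k * (c i : ℝ)) ≤ (28 / 27 : ℝ) ^ s * ∏ i, (2 ^ k * (c i : ℝ) - 1) := by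
      rw [hs, ← Finset.card_univ, ← Finset.prod_const, ← Finset.prod_mul_distrib]
      refine Finset.prod_le_prod (fun i _ => by positivity) fun i _ => ?_
      have : (28 : ℝ) ≤ 2 ^ k * (c i : ℝ) := by exact_mod_cast hN i
      linarith
    have hc' : ∏ i, ((c i : ℝ) - 1) ≤ ∏ i, (c i : ℝ) := by
      refine Finset.prod_le_prod (fun i _ => ?_) fun i _ => by linarith
      have : (1 : ℝ) ≤ c i := by exact_mod_cast hc1 i
      linarith
    have hpos : 0 ≤ ∏ i, (2 ^ k * (c i : ℝ) - 1) := by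
      refine Finset.prod_nonneg fun i _ => ?_
      have : (28 : ℝ) ≤ 2 ^ k * (c i : ℝ) := by exact_mod_cast hN i
      linarith
    have hpc : 0 ≤ ∏ i, (c i : ℝ) := by positivity
    have hcoef : 15 * (1 + (S : ℝ)) * (28 / 27) ^ s ≤ 4 * 2 ^ (k * s) := by
      have hks : (2 : ℝ) ^ s ≤ 2 ^ (k * s) :=
        pow_le_pow_right₀ (by norm_num) (Nat.le_mul_of_pos_left s hk)
      rcases Nat.lt_or_ge s 4 with h4 | h4
      · have h3 : s = 3 := by omega
        have hk2 : 2 ≤ k := by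
          by_contra h
          exact hsmall ⟨h3, by omega⟩
        rw [h3] at hS0 ⊢
        have : (2 : ℝ) ^ (2 * 3) ≤ 2 ^ (k * 3) :=
          pow_le_pow_right₀ (by norm_num) (by omega)
        norm_num at this hS0 ⊢
        nlinarith
      · have h16 : (16 : ℝ) ≤ 2 ^ s := by
          calc (16 : ℝ) = 2 ^ 4 := by norm_num
            _ ≤ 2 ^ s := pow_le_pow_right₀ (by norm_num) h4
        have h1 : (1 + (S : ℝ)) * 2 ^ s ≤ 2 * 2 ^ (k * s) := by
          have h2 : ((1 + (S : ℝ)) * 2 ^ s - 2 * 2 ^ (k * s)) * (2 ^ s - 1) ≤ 0 := by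
            have : ((1 + (S : ℝ)) * 2 ^ s - 2 * 2 ^ (k * s)) * (2 ^ s - 1) =
              (2 ^ s - 2) * (2 ^ s - 2 ^ (k * s)) := by linear_combination (2 : ℝ) ^ s * hS0
            rw [this]
            exact mul_nonpos_of_nonneg_of_nonpos (by linarith) (by linarith)
          nlinarith
        -- Equivalent to (14/27)^s ≤ 2/15, where s = 4 is the worst case.
        have h5 : (28 / 27 : ℝ) ^ s ≤ 2 / 15 * 2 ^ s := by
          have : (14 / 27 : ℝ) ^ s ≤ (14 / 27) ^ 4 :=
            pow_le_pow_of_le_one (by norm_num) (by norm_num) h4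
          have h6 : (28 / 27 : ℝ) ^ s = (14 / 27) ^ s * 2 ^ s := by rw [← mul_pow]; norm_num
          rw [h6]
          gcongr
          exact this.trans (by norm_num)
        have h0 : (0 : ℝ) ≤ 1 + S := by positivity
        calc 15 * (1 + (S : ℝ)) * (28 / 27) ^ s ≤ 15 * (1 + (S : ℝ)) * (2 / 15 * 2 ^ s) := by gcongr
          _ = 2 * ((1 + (S : ℝ)) * 2 ^ s) := by ring
          _ ≤ 2 * (2 * 2 ^ (k * s)) := by linarith
          _ = 4 * 2 ^ (k * s) := by ring
    have hfin : 15 * (∏ i, ((c i : ℝ) - 1) + S * ∏ i, (c i : ℝ)) ≤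
        4 * ∏ i, (2 ^ k * (c i : ℝ) - 1) := by
      have hA : 15 * (1 + (S : ℝ)) * (28 / 27) ^ s * ∏ i, (c i : ℝ) ≤
          4 * ((28 / 27) ^ s * ∏ i, (2 ^ k * (c i : ℝ) - 1)) := by
        calc _ ≤ 4 * 2 ^ (k * s) * ∏ i, (c i : ℝ) := by gcongr
          _ = 4 * ∏ i, (2 ^ k * (c i : ℝ)) := by rw [mul_assoc, hprodN]
          _ ≤ _ := by gcongr
      have hB : (0 : ℝ) < (28 / 27) ^ s := by positivity
      have hC : 15 * (1 + (S : ℝ)) * ∏ i, (c i : ℝ) ≤ 4 * ∏ i, (2 ^ k * (c i : ℝ) - 1) := by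
        refine le_of_mul_le_mul_left ?_ hB
        linarith
      linarith
    have e1 : ∀ i, (((c i - 1 : ℕ)) : ℝ) = (c i : ℝ) - 1 := fun i => by
      rw [Nat.cast_sub (hc1 i)]; simp
    have e2 : ∀ i, (((2 ^ k * c i - 1 : ℕ)) : ℝ) = 2 ^ k * (c i : ℝ) - 1 := fun i => by
      rw [Nat.cast_sub (by have := hN i; omega)]; simp
    rw [← Nat.cast_le (α := ℝ)]
    push_cast [e1, e2]
    exact hfin

/-- Put M = 2^k g. The smaller N is at least M and the larger exceeds it by at least M, so the right
side is about 8M² or more. Since 3S + 1 = 4^k, the left side is about 5M² + 10g², at most 7.5M² as g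
≤ M/2. For k = 1 the margin is thin and small g needs N ≥ 28. -/
theorem strong_lucas_numeric_two_aux {k g a b : ℕ} (hk : 1 ≤ k) (hg : 1 ≤ g) (hab : a < b)
    (ha : 28 ≤ 2 ^ k * g * a) :
    15 * ((g - 1) * (g - 1) + (∑ j ∈ Finset.range k, (2 ^ j) ^ 2) * (g * g)) ≤
      4 * ((2 ^ k * g * a - 1) * (2 ^ k * g * b - 1)) := by
  have ha1 : 1 ≤ a := by
    rcases Nat.eq_zero_or_pos a with h | h
    · simp [h] at ha
    · exact h
  have hS : 3 * (∑ j ∈ Finset.range k, (2 ^ j) ^ 2 : ℕ) + 1 = (2 ^ k) ^ 2 := by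
    clear hk ha
    induction k with
    | zero => simp
    | succ k ih => rw [Finset.sum_range_succ, mul_add, add_right_comm, ih]; ring
  set S := ∑ j ∈ Finset.range k, (2 ^ j) ^ 2
  have hM : 2 * g ≤ 2 ^ k * g := by
    gcongr
    calc 2 = 2 ^ 1 := by norm_num
      _ ≤ 2 ^ k := Nat.pow_le_pow_right (by norm_num) hk
  have hb : 2 ^ k * g * a + 2 ^ k * g ≤ 2 ^ k * g * b := by
    calc 2 ^ k * g * a + 2 ^ k * g = 2 ^ k * g * (a + 1) := by ring
      _ ≤ _ := by gcongr; omega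
  have ha2 : 2 ^ k * g ≤ 2 ^ k * g * a := Nat.le_mul_of_pos_right _ ha1
  have hSg : 3 * (S * (g * g)) + g * g = (2 ^ k * g) ^ 2 := by
    calc _ = (3 * S + 1) * (g * g) := by ring
      _ = _ := by rw [hS]; ring
  have hM4 : k = 1 ∨ 4 * g ≤ 2 ^ k * g := by
    rcases Nat.lt_or_ge k 2 with h | h
    · left; omega
    · right
      gcongr
      calc 4 = 2 ^ 2 := by norm_num
        _ ≤ 2 ^ k := Nat.pow_le_pow_right (by norm_num) h
  have hM2 : k = 1 → 2 ^ k * g = 2 * g := by rintro rfl; simp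
  generalize 2 ^ k * g * b = B at *
  generalize 2 ^ k * g * a = A at *
  generalize 2 ^ k * g = M at *
  obtain ⟨g, rfl⟩ := Nat.exists_eq_add_of_le' hg
  obtain ⟨A, rfl⟩ := Nat.exists_eq_add_of_le' (show 1 ≤ A by omega)
  obtain ⟨B, rfl⟩ := Nat.exists_eq_add_of_le' (show 1 ≤ B by omega)
  generalize S * ((g + 1) * (g + 1)) = T at *
  simp only [Nat.add_sub_cancel]
  have hAB : A * (A + M) ≤ A * B := Nat.mul_le_mul_left _ (by omega)
  rcases hM4 with h1 | h4
  · rw [hM2 h1] at *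
    nlinarith
  · have : (M - 1 : ℤ) * (M - 1 + M) ≤ A * (A + M) := by
      have : (M - 1 : ℤ) ≤ A := by omega
      nlinarith
    zify at *
    nlinarith

/-- Numerical bound for two prime factors. -/
theorem strong_lucas_numeric_two {k g N₁ N₂ : ℕ} (hk : 1 ≤ k) (hg : 1 ≤ g) (h1 : 2 ^ k * g ∣ N₁)
    (h2 : 2 ^ k * g ∣ N₂) (hne : N₁ ≠ N₂) (h281 : 28 ≤ N₁) (h282 : 28 ≤ N₂) :
    15 * ((g - 1) * (g - 1) + (∑ j ∈ Finset.range k, (2 ^ j) ^ 2) * (g * g)) ≤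
      4 * ((N₁ - 1) * (N₂ - 1)) := by
  obtain ⟨a, rfl⟩ := h1
  obtain ⟨b, rfl⟩ := h2
  rcases lt_trichotomy a b with h | h | h
  · exact strong_lucas_numeric_two_aux hk hg h h281
  · exact absurd (by rw [h]) hne
  · rw [mul_comm (2 ^ k * g * a - 1)]
    exact strong_lucas_numeric_two_aux hk hg h h282

/-! ### The 4/15 bound for composite candidates. -/

section SquarefreeBound

/-- Upper bound for the number of passing residues modulo a product of distinct odd primes. -/
theorem card_passResidues_prod_le {ι : Type*} [Fintype ι] [Nonempty ι] {a : ι → ℕ}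
    [∀ i, Fact (a i).Prime] (hinj : Function.Injective a) (ha2 : ∀ i, a i ≠ 2) {D : ℤ}
    (hD : ∀ i, (D : ZMod (a i)) ≠ 0) {N : ι → ℕ}
    (hN : ∀ i, (N i : ℤ) = a i - legendreSym (a i) D) (hN0 : ∀ i, 0 < N i) {κ q n : ℕ} [NeZero n]
    (hn : n = ∏ i, a i) :
    (baseResidues D n).card = ∏ i, (N i - 1) ∧
    ∃ k : ℕ, (∀ i, 2 ^ k ∣ N i) ∧ (∀ m, (∀ i, 2 ^ m ∣ N i) → m ≤ k) ∧
      (passResidues D n κ q).card ≤ ∏ i, (Nat.gcd q (N i) - 1) +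
        (∑ j ∈ Finset.range k, (2 ^ j) ^ Fintype.card ι) * ∏ i, Nat.gcd q (N i) := by
  classical
  subst hn
  have hc : Pairwise (Function.onFun Nat.Coprime a) := fun i j hij =>
    (Nat.coprime_primes (Fact.out : (a i).Prime) (Fact.out : (a j).Prime)).2 (hinj.ne hij)
  constructor
  · rw [card_baseResidues_prod D hc]
    refine Finset.prod_congr rfl fun i _ => ?_
    have := card_baseResidues_prime (D := D) (ha2 i)
    have := hN i
    have := hN0 i
    omega
  -- The exponent of 2 in G is the least exponent of 2 among the N i.
  set G := Finset.univ.gcd N with hG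
  obtain ⟨i₀⟩ := ‹Nonempty ι›
  have hG0 : G ≠ 0 := by
    rw [hG, Ne, Finset.gcd_eq_zero_iff]
    intro h
    exact (hN0 i₀).ne' (h i₀ (Finset.mem_univ _))
  have hmax : ∀ m, (∀ i, 2 ^ m ∣ N i) → m ≤ G.factorization 2 := fun m hm =>
    (Nat.prime_two.pow_dvd_iff_le_factorization hG0).1 (Finset.dvd_gcd fun i _ => hm i)
  refine ⟨G.factorization 2, fun i => (Nat.ordProj_dvd G 2).trans
    (Finset.gcd_dvd (Finset.mem_univ i)), hmax, ?_⟩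
  refine (card_passResidues_le _ _ _ _).trans (Nat.add_le_add ?_ ?_)
  · rw [card_zerosU_prod D hc]
    exact Finset.prod_le_prod' fun i _ =>
      card_zerosU_prime_le (ha2 i) (hD i) (hN i) (hN0 i) q
  -- A zero of V at 2^j q modulo every prime requires 2^(j+1) to divide every N i, so only the terms
  -- below the exponent of 2 in G survive.
  · have hterm : ∀ j, (zerosV D (∏ i, a i) (2 ^ j * q)).card ≤
        if j < G.factorization 2 then (2 ^ j) ^ Fintype.card ι * ∏ i, Nat.gcd q (N i) else 0 := by
      intro j
      rw [card_zerosV_prod D hc]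
      split_ifs with hj
      · rw [← Finset.card_univ, ← Finset.prod_const, ← Finset.prod_mul_distrib]
        refine Finset.prod_le_prod' fun i _ => ?_
        refine (card_zerosV_prime_le (ha2 i) (hD i) (hN i) (hN0 i) _).trans ?_
        rw [Nat.gcd_comm, Nat.gcd_comm q]
        refine (Nat.le_of_dvd (Nat.mul_pos (Nat.gcd_pos_of_pos_left _ (hN0 i))
          (Nat.gcd_pos_of_pos_left _ (hN0 i))) (Nat.gcd_mul_right_dvd_mul_gcd _ _ _)).trans ?_
        gcongr
        exact Nat.gcd_le_right _ (by positivity)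
      · rw [Nat.le_zero, Finset.prod_eq_zero_iff]
        by_contra hne
        push Not at hne
        have := hmax (j + 1) fun i => two_pow_dvd_of_zerosV_nonempty (ha2 i) (hD i) (hN i) (hN0 i)
          (Finset.card_ne_zero.1 (hne i (Finset.mem_univ i)))
        omega
    refine (Finset.sum_le_sum fun j _ => hterm j).trans ?_
    rw [← Finset.sum_filter, Finset.sum_mul]
    refine Finset.sum_le_sum_of_subset fun j hj => ?_
    simp only [Finset.mem_filter, Finset.mem_range] at hj ⊢
    exact hj.2

theorem two_pow_mul_gcd_dvd {k q N : ℕ} (hq : Odd q) (h : 2 ^ k ∣ N) :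
    2 ^ k * Nat.gcd q N ∣ N := by
  refine Nat.Coprime.mul_dvd_of_dvd_of_dvd ?_ h (Nat.gcd_dvd_right _ _)
  exact Nat.Coprime.pow_left _ ((Nat.coprime_two_left.2 hq).coprime_dvd_right
    (Nat.gcd_dvd_left _ _))

/-- The two-prime case, with the primes ordered by the value of the Legendre symbol. -/
theorem strong_lucas_two_primes {a b q k : ℕ} (hq : Odd q) (hqn : q ∣ a * b + 1)
    (hsq : ¬ IsSquare (a * b + 1)) (ha : 29 ≤ a) (hb : 29 ≤ b) (hk : 1 ≤ k) (hka : 2 ^ k ∣ a - 1)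
    (hkb : 2 ^ k ∣ b + 1) :
    15 * ((Nat.gcd q (a - 1) - 1) * (Nat.gcd q (b + 1) - 1) +
      (∑ j ∈ Finset.range k, (2 ^ j) ^ 2) * (Nat.gcd q (a - 1) * Nat.gcd q (b + 1))) ≤
        4 * ((a - 1 - 1) * (b + 1 - 1)) := by
  obtain ⟨c, rfl⟩ := Nat.exists_eq_add_of_le' (show 1 ≤ a by omega)
  simp only [Nat.add_sub_cancel] at *
  -- Modulo this gcd, a = c + 1 is 1, so ab + 1 reduces to b + 1. The converse divisibility is
  -- analogous, with b = -1.
  have hgc : Nat.gcd q c ∣ b + 1 := by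
    have h1 : Nat.gcd q c ∣ (b + 1) + c * b := by
      have := (Nat.gcd_dvd_left q c).trans hqn
      rwa [show (c + 1) * b + 1 = (b + 1) + c * b by ring] at this
    exact (Nat.dvd_add_left ((Nat.gcd_dvd_right q c).mul_right b)).1 h1
  have hgb : Nat.gcd q (b + 1) ∣ c := by
    have h1 : Nat.gcd q (b + 1) ∣ (c + 1) * (b + 1) := (Nat.gcd_dvd_right q (b + 1)).mul_left _
    have h2 := (Nat.gcd_dvd_left q (b + 1)).trans hqn
    rw [show (c + 1) * (b + 1) = c + ((c + 1) * b + 1) by ring] at h1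
    exact (Nat.dvd_add_left h2).1 h1
  have heq : Nat.gcd q c = Nat.gcd q (b + 1) :=
    Nat.dvd_antisymm (Nat.dvd_gcd (Nat.gcd_dvd_left _ _) hgc)
      (Nat.dvd_gcd (Nat.gcd_dvd_left _ _) hgb)
  rw [← heq]
  have := strong_lucas_numeric_two hk (Nat.gcd_pos_of_pos_left c hq.pos)
    (two_pow_mul_gcd_dvd hq hka) (heq ▸ two_pow_mul_gcd_dvd hq hkb) ?_ (by omega) (by omega)
  · simpa using this
  -- If a - 1 = b + 1, then ab + 1 = (b + 1)².
  · rintro rfl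
    exact hsq ⟨b + 1, by ring⟩

theorem twentynine_le_of_prime {p : ℕ} (hp : p.Prime) (h2 : p ≠ 2)
    (h : p ∉ ({3, 5, 7, 11, 13, 17, 19, 23} : Finset ℕ)) : 29 ≤ p := by
  by_contra hlt
  push Not at hlt
  interval_cases p <;> first | (norm_num at hp; done) | (simp at h; done) | simp at h2

/-- For a composite candidate at most `4/15` of the base residues pass the strong test. -/
theorem card_passResidues_le_four_fifteenths {D : ℤ} {n κ q : ℕ} [NeZero n] (hodd : Odd n)
    (h1 : 1 < n) (hnp : ¬ n.Prime) (hcand : IsLucasCandidate D n) (hq : Odd q)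
    (hn : n + 1 = 2 ^ κ * q) :
    15 * (passResidues D n κ q).card ≤ 4 * (baseResidues D n).card := by
  classical
  obtain ⟨hjac, hgcd, hsmall, hsq⟩ := hcand
  have hp29 : ∀ p, p.Prime → p ∣ n → 29 ≤ p := by
    intro p hp hpn
    refine twentynine_le_of_prime hp ?_ fun hmem => hsmall p hmem hpn
    rintro rfl
    exact (Nat.not_even_iff_odd.2 hodd) (even_iff_two_dvd.2 hpn)
  by_cases hsf : Squarefree n
  swap
  · rw [Nat.squarefree_iff_prime_squarefree] at hsf
    push Not at hsf
    obtain ⟨p, hp, hpp⟩ := hsf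
    have : Fact p.Prime := ⟨hp⟩
    have h2 := mul_card_passResidues_le_of_sq_dvd (D := D) hpp hn
    have h3 := hp29 p hp ((Dvd.intro _ rfl).trans hpp)
    -- A repeated prime is at least 29, and 1/29 < 4/15.
    have h4 : (passResidues D n κ q).card * 29 ≤ (passResidues D n κ q).card * p := by gcongr
    omega
  let ι := {p // p ∈ n.primeFactors}
  let a : ι → ℕ := Subtype.val
  have hprime : ∀ i : ι, (a i).Prime := fun i => Nat.prime_of_mem_primeFactors i.2
  have hfact : ∀ i : ι, Fact (a i).Prime := fun i => ⟨hprime i⟩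
  have hdvd : ∀ i : ι, a i ∣ n := fun i => Nat.dvd_of_mem_primeFactors i.2
  have h29 : ∀ i : ι, 29 ≤ a i := fun i => hp29 _ (hprime i) (hdvd i)
  have hprod : n = ∏ i, a i := by
    exact (Nat.prod_primeFactors_of_squarefree hsf).symm.trans
      (Finset.prod_coe_sort n.primeFactors fun p => p).symm
  have hD : ∀ i, (D : ZMod (a i)) ≠ 0 := by
    intro i h
    rw [ZMod.intCast_zmod_eq_zero_iff_dvd] at h
    have h2 := Int.dvd_coe_gcd h (Int.natCast_dvd_natCast.2 (hdvd i))
    rw [hgcd] at h2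
    have := Int.le_of_dvd (by norm_num) h2
    have := h29 i
    omega
  have hNex : ∀ i, ∃ N : ℕ, (N : ℤ) = a i - legendreSym (a i) D ∧ 28 ≤ N ∧ 2 ∣ N := by
    intro i
    have := h29 i
    have h2 := (hprime i).odd_of_ne_two (by omega)
    obtain ⟨m, hm⟩ := h2
    rcases legendreSym.eq_one_or_neg_one (a i) (hD i) with h | h
    · exact ⟨a i - 1, by omega, by omega, by omega⟩
    · exact ⟨a i + 1, by omega, by omega, by omega⟩
  choose N hN hN28 hN2 using hNex
  have hne : Nonempty ι := by
    obtain ⟨p, hp, hpn⟩ := Nat.exists_prime_and_dvd h1.ne'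
    exact ⟨p, Nat.mem_primeFactors.2 ⟨hp, hpn, by omega⟩⟩
  obtain ⟨hbase, k, hk, hkmax, hpass⟩ := card_passResidues_prod_le (a := a) (κ := κ) (q := q)
    Subtype.val_injective (fun i => by have := h29 i; omega) hD hN
    (fun i => by have := hN28 i; omega) hprod
  have hk1 : 1 ≤ k := hkmax 1 fun i => by rw [pow_one]; exact hN2 i
  rw [hbase]
  refine (Nat.mul_le_mul_left 15 hpass).trans ?_
  rcases Nat.lt_or_ge (Fintype.card ι) 3 with hlt | hge
  swap
  · choose c hc using hk
    have := strong_lucas_numeric_many (c := c) (g := fun i => Nat.gcd q (N i)) hk1 hge ?_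
      (fun i => hc i ▸ hN28 i)
    · simpa only [← hc] using this
    · intro i
      have h2 := two_pow_mul_gcd_dvd hq (Dvd.intro _ (hc i).symm : 2 ^ k ∣ N i)
      have hc0 : 0 < c i := by
        rcases Nat.eq_zero_or_pos (c i) with h | h
        · have h3 := hN28 i; rw [hc i, h] at h3; simp at h3
        · exact h
      refine Nat.le_of_dvd hc0 (Nat.dvd_of_mul_dvd_mul_left (k := 2 ^ k) (by positivity) ?_)
      exact h2.trans (dvd_of_eq (hc i))
  have hcard : Fintype.card ι = 2 := by
    have h0 : 0 < Fintype.card ι := Fintype.card_pos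
    by_contra h2
    have h3 : Fintype.card ι = 1 := by omega
    obtain ⟨x, hx⟩ := Fintype.card_eq_one_iff.1 h3
    apply hnp
    have : (Finset.univ : Finset ι) = {x} := by ext y; simp [hx y]
    rw [hprod, this, Finset.prod_singleton]
    exact hprime x
  rw [hcard]
  have hcard' := hcard
  rw [← Finset.card_univ, Finset.card_eq_two] at hcard'
  obtain ⟨x, y, hxy, hu⟩ := hcard'
  rw [hu] at hprod ⊢
  rw [Finset.prod_pair hxy] at hprod
  simp only [Finset.prod_pair hxy]
  have hqn : q ∣ a x * a y + 1 := by rw [← hprod, hn]; exact Dvd.intro_left _ rfl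
  have hsq' : ¬ IsSquare (a x * a y + 1) := by
    rintro ⟨r, hr⟩
    apply hsq
    refine ⟨r, ?_⟩
    rw [hjac, hprod]
    push_cast
    have : ((a x * a y + 1 : ℕ) : ℤ) = ((r * r : ℕ) : ℤ) := by rw [hr]
    push_cast at this
    linarith
  -- Exactly one of the two symbols is 1, so the two orders are one prime minus 1 and the other plus
  -- 1.
  have hjac2 : legendreSym (a x) D * legendreSym (a y) D = -1 := by
    rw [jacobiSym.legendreSym.to_jacobiSym, jacobiSym.legendreSym.to_jacobiSym, ← hjac, hprod, jacobiSym.mul_right]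
  have hx := hN x
  have hy := hN y
  have hax := h29 x
  have hay := h29 y
  rcases legendreSym.eq_one_or_neg_one (a x) (hD x) with h | h
  · have h' : legendreSym (a y) D = -1 := by rw [h] at hjac2; linarith
    have hx' : N x = a x - 1 := by omega
    have hy' : N y = a y + 1 := by omega
    have := strong_lucas_two_primes hq hqn hsq' hax hay hk1 (hx' ▸ hk x) (hy' ▸ hk y)
    rw [hx', hy']
    exact this
  · have h' : legendreSym (a y) D = 1 := by rw [h] at hjac2; linarith
    have hx' : N x = a x + 1 := by omega
    have hy' : N y = a y - 1 := by omega
    rw [mul_comm (a x)] at hqn hsq'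
    have := strong_lucas_two_primes hq hqn hsq' hay hax hk1 (hy' ▸ hk y) (hx' ▸ hk x)
    rw [hx', hy', mul_comm (Nat.gcd q (a x + 1) - 1), mul_comm (Nat.gcd q (a x + 1)),
      mul_comm (a x + 1 - 1)]
    exact this

end SquarefreeBound

/-! ### From bases (P, Q) to residues of P. -/

section Bases

theorem natCast_dvd_iff_of_two_pow_mul {n : ℕ} (hodd : Odd n) {m : ℕ} {u : ℤ} {b : ZMod n}
    (h : (2 : ZMod n) ^ m * (u : ZMod n) = 2 * b) : (n : ℤ) ∣ u ↔ b = 0 := by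
  have h2 : IsUnit (2 : ZMod n) := by
    have := (ZMod.isUnit_iff_coprime 2 n).2 (Nat.coprime_two_left.2 hodd)
    exact_mod_cast this
  rw [← ZMod.intCast_zmod_eq_zero_iff_dvd, ← (h2.pow m).mul_right_eq_zero, h,
    h2.mul_right_eq_zero]

theorem strongLucasCriterion_iff {D : ℤ} {n κ q : ℕ} [NeZero n] (hodd : Odd n)
    (hjac : jacobiSym D n = -1) (hq : Odd q) (hn : n + 1 = 2 ^ κ * q) {P Q : ℤ}
    (hPQ : P ^ 2 - 4 * Q ≡ D [ZMOD n]) :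
    StrongLucasCriterion D n P Q ↔ ((lucasPair (D : ZMod n) (P : ZMod n) q).2 = 0 ∨
      ∃ i < κ, (lucasPair (D : ZMod n) (P : ZMod n) (2 ^ i * q)).1 = 0) := by
  have hd : (P : ZMod n) ^ 2 - 4 * (Q : ZMod n) = (D : ZMod n) := by
    have := (ZMod.intCast_eq_intCast_iff _ _ n).2 hPQ
    exact_mod_cast this
  have hU := fun m => natCast_dvd_iff_of_two_pow_mul hodd (two_pow_mul_lucasU hd m)
  have hV := fun m => natCast_dvd_iff_of_two_pow_mul hodd (two_pow_mul_lucasV hd m)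
  constructor
  · rintro ⟨κ', q', hq', hn', h⟩
    have h1 : 2 ^ κ * q = 2 ^ κ' * q' := by
      rw [hjac] at hn'
      have : ((2 ^ κ * q : ℕ) : ℤ) = ((2 ^ κ' * q' : ℕ) : ℤ) := by
        rw [← hn]; push_cast; linarith
      exact_mod_cast this
    -- The exponent of 2 in n + 1 determines κ, so the existential in the criterion has only one
    -- witness.
    have hk : κ = κ' := by
      have hf : ∀ (e : ℕ) {r : ℕ}, Odd r → (2 ^ e * r).factorization 2 = e := by
        intro e r hr
        rw [Nat.factorization_mul (by positivity) hr.pos.ne', Nat.Prime.factorization_pow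
          Nat.prime_two]
        simp [Nat.factorization_eq_zero_of_not_dvd (fun h => (Nat.not_even_iff_odd.2 hr)
          (even_iff_two_dvd.2 h))]
      rw [← hf κ hq, h1, hf κ' hq']
    subst hk
    have hqq : q = q' := Nat.eq_of_mul_eq_mul_left (by positivity) h1
    subst hqq
    simpa only [hU, hV] using h
  · intro h
    refine ⟨κ, q, hq, ?_, ?_⟩
    · rw [hjac]
      have : ((n + 1 : ℕ) : ℤ) = ((2 ^ κ * q : ℕ) : ℤ) := by rw [hn]
      push_cast at this
      linarith
    · simpa only [hU, hV] using h

open Classical in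
/-- The bases `(P, Q)` correspond to the base residues through `(P, Q) ↦ P`. -/
theorem card_filter_lucasBases {D : ℤ} {n : ℕ} [NeZero n] (hodd : Odd n) (C : ZMod n → Prop) :
    ((lucasBases D n).filter fun b => C (b.1 : ZMod n)).card =
      (Finset.univ.filter fun x : ZMod n => IsUnit (x ^ 2 - (D : ZMod n)) ∧ C x).card := by
  have h2 : IsUnit (2 : ZMod n) := by
    have := (ZMod.isUnit_iff_coprime 2 n).2 (Nat.coprime_two_left.2 hodd)
    exact_mod_cast this
  have h4 : IsUnit (4 : ZMod n) := by
    have := h2.pow 2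
    norm_num at this
    exact this
  have hval : ∀ {y : ℕ}, y < n → ((y : ZMod n)).val = y := fun h => ZMod.val_cast_of_lt h
  have hcong : ∀ P Q : ℕ, ((P : ℤ) ^ 2 - 4 * (Q : ℤ) ≡ D [ZMOD (n : ℤ)]) ↔
      (P : ZMod n) ^ 2 - (D : ZMod n) = 4 * (Q : ZMod n) := by
    intro P Q
    rw [← ZMod.intCast_eq_intCast_iff]
    push_cast
    constructor <;> intro h <;> linear_combination h
  refine Finset.card_nbij (fun b => (b.1 : ZMod n)) ?_ ?_ ?_
  · intro b hb
    simp only [lucasBases, Finset.coe_filter, Set.mem_ofPred_eq, Finset.mem_filter,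
      Finset.mem_product, Finset.mem_range, hcong, Finset.mem_univ, true_and] at hb ⊢
    refine ⟨?_, hb.2⟩
    rw [hb.1.2.2]
    exact h4.mul ((ZMod.isUnit_iff_coprime _ _).2 hb.1.2.1)
  · intro b hb c hc hbc
    simp only [lucasBases, Finset.coe_filter, Set.mem_ofPred_eq, Finset.mem_filter,
      Finset.mem_product, Finset.mem_range, hcong] at hb hc hbc
    have h1 : b.1 = c.1 := by rw [← hval hb.1.1.1, hbc, hval hc.1.1.1]
    have h3 : (b.2 : ZMod n) = c.2 := by
      apply h4.mul_left_cancel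
      rw [← hb.1.2.2, ← hc.1.2.2, hbc]
    have h5 : b.2 = c.2 := by rw [← hval hb.1.1.2, h3, hval hc.1.1.2]
    exact Prod.ext h1 h5
  · intro x hx
    simp only [Finset.coe_filter, Finset.mem_univ, true_and, Set.mem_ofPred_eq] at hx
    obtain ⟨⟨v, hv⟩, hC⟩ := hx
    obtain ⟨w, hw⟩ := h4
    -- Q is recovered as (x² - D)/4, a unit because both 4 and x² - D are.
    refine ⟨(x.val, ((w⁻¹ * v : (ZMod n)ˣ) : ZMod n).val), ?_, ZMod.natCast_zmod_val x⟩
    simp only [lucasBases, Finset.coe_filter, Set.mem_ofPred_eq, Finset.mem_filter,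
      Finset.mem_product, Finset.mem_range, hcong, ZMod.natCast_zmod_val]
    refine ⟨⟨⟨ZMod.val_lt _, ZMod.val_lt _⟩, ?_, ?_⟩, hC⟩
    · exact (ZMod.val_coe_unit_coprime _)
    · rw [← hv, ← hw]; simp

open Classical in
theorem card_lucasBases {D : ℤ} {n : ℕ} [NeZero n] (hodd : Odd n) :
    (lucasBases D n).card = (baseResidues D n).card := by
  have := card_filter_lucasBases (D := D) hodd fun _ => True
  simpa [baseResidues] using this

open Classical in
theorem card_passing_lucasBases {D : ℤ} {n κ q : ℕ} [NeZero n] (hodd : Odd n)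
    (hjac : jacobiSym D n = -1) (hq : Odd q) (hn : n + 1 = 2 ^ κ * q) :
    ((lucasBases D n).filter fun b => StrongLucasCriterion D n b.1 b.2).card =
      (passResidues D n κ q).card := by
  have := card_filter_lucasBases (D := D) hodd fun x => (lucasPair (D : ZMod n) x q).2 = 0 ∨
    ∃ i < κ, (lucasPair (D : ZMod n) x (2 ^ i * q)).1 = 0
  convert this using 2
  · ext b
    simp only [Finset.mem_filter]
    refine and_congr_right fun hb => ?_
    simp only [lucasBases, Finset.mem_filter] at hb
    rw [strongLucasCriterion_iff hodd hjac hq hn hb.2.2]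
    simp
  · ext x
    simp only [passResidues, Finset.mem_filter]

open Classical in
theorem four_fifteenths_of_composite {D : ℤ} {n : ℕ} (hodd : Odd n) (h1 : 1 < n)
    (hnp : ¬ n.Prime) (hcand : IsLucasCandidate D n) :
    15 * ((lucasBases D n).filter fun b => StrongLucasCriterion D n b.1 b.2).card ≤
      4 * (lucasBases D n).card := by
  have : NeZero n := ⟨by omega⟩
  obtain ⟨κ, q, hq, hn⟩ := Nat.exists_eq_two_pow_mul_odd (show n + 1 ≠ 0 by omega)
  rw [card_passing_lucasBases hodd hcand.1 hq hn, card_lucasBases hodd]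
  exact card_passResidues_le_four_fifteenths hodd h1 hnp hcand hq hn

open Classical in
theorem all_bases_pass_of_prime {D : ℤ} {p : ℕ} (hp : p.Prime) (hp2 : p ≠ 2)
    (hcand : IsLucasCandidate D p) :
    (lucasBases D p).Nonempty ∧
      ((lucasBases D p).filter fun b => StrongLucasCriterion D p b.1 b.2).card =
        (lucasBases D p).card := by
  have : Fact p.Prime := ⟨hp⟩
  have hodd := hp.odd_of_ne_two hp2
  have hjac : legendreSym p D = -1 := by rw [jacobiSym.legendreSym.to_jacobiSym]; exact hcand.1
  obtain ⟨κ, q, hq, hn⟩ := Nat.exists_eq_two_pow_mul_odd (show p + 1 ≠ 0 by omega)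
  have hD : (D : ZMod p) ≠ 0 := by
    intro h
    rw [(legendreSym.eq_zero_iff p D).2 h] at hjac
    norm_num at hjac
  constructor
  · rw [← Finset.card_pos, card_lucasBases hodd]
    have := card_baseResidues_prime (D := D) hp2
    have := hp.pos
    omega
  · rw [card_passing_lucasBases hodd hcand.1 hq hn, card_lucasBases hodd]
    congr 1
    refine Finset.filter_congr fun x _ => ?_
    rw [and_iff_left_iff_imp]
    intro hx
    exact prime_passes hp2 hD (by rw [← hn, hjac]; push_cast; ring) hx

end Bases

/-! ### The distribution of the output. -/

section Algorithm

theorem ENNReal.tsum_option {α : Type*} (f : Option α → ℝ≥0∞) :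
    ∑' o, f o = f none + ∑' a, f (some a) := by
  classical
  rw [ENNReal.tsum_eq_add_tsum_ite none, ← (Option.some_injective α).tsum_eq]
  · simp
  · intro o ho
    cases o with
    | none => simp at ho
    | some a => exact ⟨a, rfl⟩

open Classical in
/-- The proportion of bases for which `n` passes one round. -/
noncomputable def passRatio (D : ℤ) (n : ℕ) : ℝ :=
  (((lucasBases D n).filter fun b => StrongLucasCriterion D n b.1 b.2).card : ℝ) /
    (lucasBases D n).card

theorem passRatio_nonneg (D : ℤ) (n : ℕ) : 0 ≤ passRatio D n := by
  unfold passRatio; positivity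

theorem lucasRound_true (D : ℤ) (n : ℕ) :
    lucasRound D n true = ENNReal.ofReal (passRatio D n) := by
  classical
  unfold lucasRound passRatio
  split_ifs with h
  · rw [← PMF.toOuterMeasure_apply_singleton, PMF.toOuterMeasure_map_apply,
      PMF.toOuterMeasure_uniformOfFinset_apply, ENNReal.ofReal_div_of_pos
        (by exact_mod_cast h.card_pos), ENNReal.ofReal_natCast, ENNReal.ofReal_natCast]
    congr 3
    refine Finset.filter_congr fun b _ => ?_
    simp
  -- Without bases the ratio is 0/0 = 0, in agreement with the round counting as failed.
  · rw [Finset.not_nonempty_iff_eq_empty] at h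
    simp [h]

theorem lucasRounds_true (D : ℤ) (n t : ℕ) :
    lucasRounds D n t true = ENNReal.ofReal (passRatio D n ^ t) := by
  induction t with
  | zero => simp [lucasRounds]
  | succ t ih =>
    rw [lucasRounds, PMF.bind_apply, tsum_bool, pow_succ',
      ENNReal.ofReal_mul (passRatio_nonneg D n), ← ih, ← lucasRound_true]
    simp

open Classical in
/-- The (real) probability that one pass outputs a number from `S`. -/
noncomputable def outputWeight (D : ℤ) (k t : ℕ) (S : Set ℕ) : ℝ :=
  (∑ n ∈ (oddBits k).filter fun n => IsLucasCandidate D n ∧ n ∈ S, passRatio D n ^ t) /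
    (oddBits k).card

theorem outputWeight_nonneg (D : ℤ) (k t : ℕ) (S : Set ℕ) : 0 ≤ outputWeight D k t S := by
  classical
  unfold outputWeight
  exact div_nonneg (Finset.sum_nonneg fun n _ => pow_nonneg (passRatio_nonneg D n) t)
    (Nat.cast_nonneg _)

theorem strongLucAttempt_image_some (D : ℤ) {k t : ℕ} (hk : 2 ≤ k) (S : Set ℕ) :
    (strongLucAttempt D k t).toOuterMeasure (some '' S) =
      ENNReal.ofReal (outputWeight D k t S) := by
  classical
  have hne : (oddBits k).Nonempty := by
    refine ⟨2 ^ (k - 1) + 1, ?_⟩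
    obtain ⟨k, rfl⟩ := Nat.exists_eq_add_of_le' hk
    have h1 : 1 ≤ 2 ^ k := Nat.one_le_two_pow
    simp only [oddBits, Finset.mem_filter, Finset.mem_Ico, show k + 2 - 1 = k + 1 by omega,
      pow_succ]
    omega
  have hterm : ∀ n, (if IsLucasCandidate D n then
        (lucasRounds D n t).map fun ok => if ok = true then some n else none
      else PMF.pure none).toOuterMeasure (some '' S) =
      if IsLucasCandidate D n ∧ n ∈ S then ENNReal.ofReal (passRatio D n ^ t) else 0 := by
    intro n
    by_cases hc : IsLucasCandidate D n
    · rw [if_pos hc, PMF.toOuterMeasure_map_apply]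
      by_cases hS : n ∈ S
      · rw [if_pos ⟨hc, hS⟩, ← lucasRounds_true, ← PMF.toOuterMeasure_apply_singleton]
        congr 1
        ext b
        cases b <;> simp [hS]
      · rw [if_neg fun h => hS h.2, ← nonpos_iff_eq_zero,
          ← (lucasRounds D n t).toOuterMeasure.empty]
        refine (MeasureTheory.measure_mono ?_)
        intro b
        cases b <;> simp [hS]
    · rw [if_neg hc, if_neg fun h => hc h.1, PMF.toOuterMeasure_pure_apply]
      simp
  unfold strongLucAttempt
  rw [dif_pos hne, PMF.toOuterMeasure_bind_apply]
  simp only [hterm]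
  rw [tsum_eq_sum (s := oddBits k)]
  · unfold outputWeight
    rw [ENNReal.ofReal_div_of_pos (by exact_mod_cast hne.card_pos), ENNReal.ofReal_natCast,
      ENNReal.ofReal_sum_of_nonneg (fun n _ => pow_nonneg (passRatio_nonneg D n) t),
      Finset.sum_filter, div_eq_mul_inv, Finset.sum_mul]
    refine Finset.sum_congr rfl fun n hn => ?_
    rw [PMF.uniformOfFinset_apply_of_mem hne hn, mul_comm]
  · intro n hn
    rw [PMF.uniformOfFinset_apply_of_notMem hne hn, zero_mul]

/-- The composite numbers greater than one. -/
def composites : Set ℕ := {n | 1 < n ∧ ¬ n.Prime}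

theorem compositeOutput_eq : compositeOutput = some '' composites := by
  ext out
  simp only [compositeOutput, composites, Set.mem_ofPred_eq, Set.mem_image]
  constructor
  · rintro ⟨n, rfl, h⟩; exact ⟨n, h, rfl⟩
  · rintro ⟨n, h, rfl⟩; exact ⟨n, rfl, h⟩

theorem strongLucAttempt_none (D : ℤ) {k t : ℕ} (hk : 2 ≤ k) :
    (strongLucAttempt D k t) none = ENNReal.ofReal (1 - outputWeight D k t Set.univ) ∧
      outputWeight D k t Set.univ ≤ 1 := by
  classical
  have h := strongLucAttempt_image_some D (t := t) hk Set.univ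
  have hsum := (strongLucAttempt D k t).tsum_coe
  have h1 : (strongLucAttempt D k t) none +
      (strongLucAttempt D k t).toOuterMeasure (some '' Set.univ) = 1 := by
    rw [← hsum, PMF.toOuterMeasure_apply, ENNReal.tsum_option]
    rw [ENNReal.tsum_option]
    simp [Set.indicator]
  rw [h] at h1
  have hle : outputWeight D k t Set.univ ≤ 1 := by
    have : ENNReal.ofReal (outputWeight D k t Set.univ) ≤ 1 := h1 ▸ le_add_self
    simpa using this
  refine ⟨?_, hle⟩
  rw [ENNReal.ofReal_sub _ (outputWeight_nonneg _ _ _ _), ENNReal.ofReal_one]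
  exact ENNReal.eq_sub_of_add_eq ENNReal.ofReal_ne_top h1

/-- The i-th summand accounts for i discarded candidates followed by a composite output. -/
theorem strongLuc_compositeOutput (D : ℤ) {k t : ℕ} (hk : 2 ≤ k) (m : ℕ) :
    (strongLuc D k t m).toOuterMeasure compositeOutput =
      ENNReal.ofReal (outputWeight D k t composites *
        ∑ i ∈ Finset.range m, (1 - outputWeight D k t Set.univ) ^ i) := by
  classical
  obtain ⟨hnone, hle⟩ := strongLucAttempt_none D (t := t) hk
  have ha := strongLucAttempt_image_some D (t := t) hk composites
  have h0 := outputWeight_nonneg D k t composites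
  have hs : 0 ≤ 1 - outputWeight D k t Set.univ := by linarith
  induction m with
  | zero => simp [strongLuc, compositeOutput]
  | succ m ih =>
    rw [strongLuc, PMF.toOuterMeasure_bind_apply, ENNReal.tsum_option]
    have hsome : ∑' n : ℕ, (strongLucAttempt D k t) (some n) *
        (PMF.pure (some n)).toOuterMeasure compositeOutput =
          ENNReal.ofReal (outputWeight D k t composites) := by
      rw [← ha, PMF.toOuterMeasure_apply, ENNReal.tsum_option, compositeOutput_eq]
      simp [PMF.toOuterMeasure_pure_apply, Set.indicator]
    simp only [hsome, ih, hnone]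
    -- The term i = 0 is split off: it belongs to the first candidate, and the rest to a restart
    -- after a discard.
    rw [← ENNReal.ofReal_mul hs, ← ENNReal.ofReal_add (by positivity) h0, Finset.sum_range_succ']
    congr 1
    simp only [pow_succ, ← Finset.sum_mul]
    ring

/-- The output of the algorithm is distributed as that of one pass, conditioned on success. -/
theorem compositeProb_eq (D : ℤ) {k : ℕ} (t : ℕ) (hk : 2 ≤ k) :
    compositeProb D k t = outputWeight D k t composites / outputWeight D k t Set.univ ∧
      outputWeight D k t composites ≤ outputWeight D k t Set.univ := by
  classical
  obtain ⟨-, hle⟩ := strongLucAttempt_none D (t := t) hk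
  have h0 := outputWeight_nonneg D k t composites
  have hab : outputWeight D k t composites ≤ outputWeight D k t Set.univ := by
    unfold outputWeight
    refine div_le_div_of_nonneg_right (Finset.sum_le_sum_of_subset_of_nonneg ?_
      fun n _ _ => pow_nonneg (passRatio_nonneg D n) t) (Nat.cast_nonneg _)
    intro n
    simp only [Finset.mem_filter, Set.mem_univ, and_true]
    tauto
  refine ⟨?_, hab⟩
  unfold compositeProb
  simp only [strongLuc_compositeOutput D hk]
  -- If no number is ever output, the probability is 0 and the quotient is 0/0 = 0.
  rcases (h0.trans hab).eq_or_lt with hz | hz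
  · have : outputWeight D k t composites = 0 := by linarith
    simp [this]
  · have hmono : Monotone fun m : ℕ => ENNReal.ofReal (outputWeight D k t composites *
        ∑ i ∈ Finset.range m, (1 - outputWeight D k t Set.univ) ^ i) := by
      intro m m' hmm
      refine ENNReal.ofReal_le_ofReal (mul_le_mul_of_nonneg_left ?_ h0)
      exact Finset.sum_le_sum_of_subset_of_nonneg (Finset.range_mono hmm)
        fun i _ _ => pow_nonneg (by linarith) i
    have hlim : Filter.Tendsto (fun m : ℕ => ENNReal.ofReal (outputWeight D k t composites *
        ∑ i ∈ Finset.range m, (1 - outputWeight D k t Set.univ) ^ i)) Filter.atTop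
        (nhds (ENNReal.ofReal (outputWeight D k t composites *
          (1 - (1 - outputWeight D k t Set.univ))⁻¹))) :=
      ENNReal.tendsto_ofReal ((hasSum_geometric_of_lt_one (by linarith)
        (by linarith)).tendsto_sum_nat.const_mul _)
    rw [tendsto_nhds_unique (tendsto_atTop_iSup hmono) hlim, sub_sub_cancel, ← div_eq_mul_inv,
      ENNReal.toReal_ofReal (by positivity)]

theorem passRatio_le_of_composite {D : ℤ} {k n : ℕ} (hn : n ∈ oddBits k)
    (hcand : IsLucasCandidate D n) (hcomp : n ∈ composites) : passRatio D n ≤ 4 / 15 := by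
  classical
  have hodd : Odd n := Nat.odd_iff.2 (Finset.mem_filter.1 hn).2
  have h := four_fifteenths_of_composite hodd hcomp.1 hcomp.2 hcand
  unfold passRatio
  refine div_le_of_le_mul₀ (Nat.cast_nonneg _) (by norm_num) ?_
  have h' : (15 : ℝ) * ((lucasBases D n).filter fun b => StrongLucasCriterion D n b.1 b.2).card ≤
    4 * (lucasBases D n).card := by exact_mod_cast h
  linarith

theorem passRatio_of_prime {D : ℤ} {k p : ℕ} (hn : p ∈ oddBits k)
    (hcand : IsLucasCandidate D p) (hp : p.Prime) : passRatio D p = 1 := by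
  classical
  have hodd : p % 2 = 1 := (Finset.mem_filter.1 hn).2
  obtain ⟨hne, h⟩ := all_bases_pass_of_prime hp (by omega) hcand
  unfold passRatio
  rw [h, div_self]
  exact_mod_cast hne.card_pos.ne'

theorem outputWeight_composites_le (D : ℤ) (k : ℕ) {r t : ℕ} (hrt : r ≤ t) :
    outputWeight D k t composites ≤ (4 / 15) ^ (t - r) * outputWeight D k r composites := by
  classical
  unfold outputWeight
  rw [← mul_div_assoc, Finset.mul_sum]
  gcongr with n hn
  obtain ⟨e, rfl⟩ := Nat.exists_eq_add_of_le hrt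
  simp only [Finset.mem_filter] at hn
  have h1 := passRatio_le_of_composite hn.1 hn.2.1 hn.2.2
  have h0 := passRatio_nonneg D n
  rw [Nat.add_sub_cancel_left, pow_add, mul_comm]
  gcongr

/-- The weight of the primes does not depend on the number of rounds. -/
theorem outputWeight_univ (D : ℤ) {k : ℕ} (hk : 2 ≤ k) (t : ℕ) :
    outputWeight D k t Set.univ =
      outputWeight D k t composites + outputWeight D k 0 {p | p.Prime} := by
  classical
  unfold outputWeight
  rw [← add_div, ← Finset.sum_filter_add_sum_filter_not _ (fun n => ¬ n.Prime)]
  congr 1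
  congr 1
  · refine Finset.sum_congr ?_ fun _ _ => rfl
    ext n
    simp only [Finset.mem_filter, Set.mem_univ, and_true]
    simp only [composites, Set.mem_ofPred_eq]
    constructor
    · rintro ⟨⟨h1, h2⟩, h3⟩
      -- k ≥ 2 excludes n = 1, which is neither prime nor composite.
      refine ⟨h1, h2, ?_, h3⟩
      have h4 := (Finset.mem_Ico.1 (Finset.mem_filter.1 h1).1).1
      have h5 : 2 ^ 1 ≤ 2 ^ (k - 1) := Nat.pow_le_pow_right (by norm_num) (by omega)
      omega
    · rintro ⟨h1, h2, -, h3⟩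
      exact ⟨⟨h1, h2⟩, h3⟩
  · refine Finset.sum_congr ?_ fun p hp => ?_
    · ext n
      simp only [Finset.mem_filter, Set.mem_univ, and_true, Set.mem_ofPred_eq, not_not, and_assoc]
    · simp only [Finset.mem_filter, Set.mem_ofPred_eq] at hp
      rw [passRatio_of_prime hp.1 hp.2.1 hp.2.2, one_pow, one_pow]

/-- The odds q_r / (1 - q_r) are the ratio of composite to prime weight. The numerator shrinks by
4/15 with each further round, while the denominator is constant. -/
theorem compositeProb_le (D : ℤ) {k : ℕ} (hk : 2 ≤ k) {r t : ℕ} (hrt : r ≤ t)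
    (hr : compositeProb D k r < 1) :
    compositeProb D k t ≤
      (4 / 15 : ℝ) ^ (t - r) * (compositeProb D k r / (1 - compositeProb D k r)) := by
  have hC := outputWeight_composites_le D k hrt
  have hr0 := outputWeight_nonneg D k r composites
  have ht0 := outputWeight_nonneg D k t composites
  have hP0 := outputWeight_nonneg D k 0 {p | p.Prime}
  rw [(compositeProb_eq D r hk).1, outputWeight_univ D hk r] at hr ⊢
  rw [(compositeProb_eq D t hk).1, outputWeight_univ D hk t]
  generalize outputWeight D k 0 {p | p.Prime} = P at *
  generalize outputWeight D k r composites = R at *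
  generalize outputWeight D k t composites = T at *
  -- Without prime weight, q_r would be R/R = 1 unless R = 0, so q_r < 1 makes all weights vanish.
  rcases hP0.eq_or_lt with rfl | hP
  · have hR : R = 0 := by
      by_contra hR
      rw [add_zero, div_self hR] at hr
      exact lt_irrefl _ hr
    have hT : T = 0 := le_antisymm (by simpa [hR] using hC) ht0
    simp [hR, hT]
  · have hodds : R / (R + P) / (1 - R / (R + P)) = R / P := by
      have : R + P ≠ 0 := by positivity
      rw [one_sub_div this, add_sub_cancel_left, div_div_div_cancel_right₀ this]
    rw [hodds]
    calc T / (T + P) ≤ T / P := by gcongr; linarith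
      _ ≤ (4 / 15) ^ (t - r) * R / P := by gcongr
      _ = _ := by ring

end Algorithm

theorem mainTheorem2 (D : ℤ) (k : ℕ) (hk : 2 ≤ k) :
    (∀ r t : ℕ, r < t → compositeProb D k r < 1 →
      compositeProb D k t ≤
        (4 / 15 : ℝ) ^ (t - r) * (compositeProb D k r / (1 - compositeProb D k r))) ∧
    (∀ r : ℕ, compositeProb D k r ≤ 1 / (1 + (15 / 4 : ℝ) ^ r) →
      (∀ r' : ℕ, 1 ≤ r' → r' < r → compositeProb D k r' ≤ (4 / 15 : ℝ) ^ r') →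
      ∀ t : ℕ, 1 ≤ t → compositeProb D k t ≤ (4 / 15 : ℝ) ^ t) := by
  refine ⟨fun r t hrt hr => compositeProb_le D hk hrt.le hr, fun r hr hsmall t ht => ?_⟩
  rcases lt_or_ge t r with htr | hrt
  · exact hsmall t ht htr
  have hpos : (0 : ℝ) < (15 / 4) ^ r := by positivity
  have hlt : compositeProb D k r < 1 := hr.trans_lt (by
    rw [div_lt_one (by positivity)]; linarith)
  refine (compositeProb_le D hk hrt hlt).trans ?_
  -- q ≤ 1/(1 + c) says precisely that the odds q/(1 - q) are at most 1/c, here with c = (15/4)^r.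
  have hodds : compositeProb D k r / (1 - compositeProb D k r) ≤ (4 / 15) ^ r := by
    have hinv : (4 / 15 : ℝ) ^ r = ((15 / 4) ^ r)⁻¹ := by rw [← inv_pow]; norm_num
    rw [hinv, div_le_iff₀ (by linarith), ← div_eq_inv_mul, le_div_iff₀ hpos]
    rw [le_div_iff₀ (by positivity)] at hr
    linarith
  calc _ ≤ (4 / 15 : ℝ) ^ (t - r) * (4 / 15) ^ r := by gcongr
    _ = (4 / 15) ^ t := by rw [← pow_add, Nat.sub_add_cancel hrt]
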